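/- Let $P\subseteq\mathbb{R}^d$ be a rational polytope, i.e. the convex hull of a finite (possibly empty) set of points of $\mathbb{Q}^d$. Let $r=\dim P$, let $q$ be the smallest positive integer such that $qv\in\mathbb{Z}^d$ for every vertex $v$ of $P$ (so $q=1$ for $P=\emptyset$), and let $$\mathrm{C}(P)=\{c(p,1)\mid c\ge 0,\ p\in P\}\subseteq\mathbb{R}^{d+1}.$$ For a homogeneous polynomial $w\in\mathbb{R}[x_1,\dots,x_{d+1}]$ of degree $m$, consider the weighted Ehrhart series $$\mathrm{Ehr}(P,w;t)=\sum_{x\in \mathrm{C}(P)\cap\mathbb{Z}^{d+1}} w(x)\,t^{x_{d+1}} .$$ Then $$\mathrm{Ehr}(P,w;t)=\frac{h^*_{P,w}(t)}{(1-t^q)^{r+m+1}}$$ for a (unique) polynomial $h^*_{P,w}(t)\in\mathbb{R}[t]$, which has degree at most $q(r+m+1)-1$; it is called the weighted $h^*$-polynomial of $P$. (For $w=0$ or $P=\emptyset$ it is zero.) Let $R_P$ be the set of all finite sums of terms $c\,\ell_1\cdots\ell_k$ with $c\ge 0$ real, $k\ge 0$, and $\ell_1,\dots,\ell_k$ linear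 forms on $\mathbb{R}^{d+1}$ that are nonnegative on $\mathrm{C}(P)$. Let $S_P$ be the set of all finite sums of terms $c\,\ell_1\cdots\ell_k$ with $c\ge 0$ real, $k\ge 0$, and $\ell_1,\dots,\ell_k$ arbitrary linear forms on $\mathbb{R}^{d+1}$ whose product $\ell_1\cdots\ell_k$ is nonnegative on $P\times\{1\}$. 1. If $w\in R_P$, then all coefficients of $h^*_{P,w}(t)$ are nonnegative. 2. If $w\in S_P$, then $h^*_{P,w}(t)\ge 0$ for all real $t\ge 0$. -/

import Mathlib

open scoped BigOperators

noncomputable section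

namespace WeightedEhrhart

variable {d : ℕ}

/-- A rational polytope in `ℝ^d`: the convex hull of finitely many rational points
(the empty polytope is included). -/
def IsRationalPolytope (P : Set (Fin d → ℝ)) : Prop :=
  ∃ V : Finset (Fin d → ℚ),
    P = convexHull ℝ ((fun (v : Fin d → ℚ) (i : Fin d) => (v i : ℝ)) '' (V : Set (Fin d → ℚ)))

/-- The denominator of `P`: the smallest positive integer `q` such that `q v ∈ ℤ^d` for every
vertex `v` of `P`.  It is `1` for the empty polytope. -/
def denominator (P : Set (Fin d → ℝ)) : ℕ :=
  sInf {q : ℕ | 0 < q ∧ ∀ v ∈ Set.extremePoints ℝ P, ∃ z : Fin d → ℤ, ∀ i, (q : ℝ) * v i = z i}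

/-- The dimension of `P`, i.e. that of its affine hull.  (For `P = ∅` this is `0`; the value is
irrelevant there, since the Ehrhart series of `∅` vanishes.) -/
def dimension (P : Set (Fin d → ℝ)) : ℕ :=
  Module.finrank ℝ (vectorSpan ℝ P)

/-- The point `(p, 1) ∈ ℝ^(d+1)`. -/
def lift (p : Fin d → ℝ) : Fin (d + 1) → ℝ :=
  Fin.snoc (α := fun _ => ℝ) p 1

/-- The cone over `P`: `{c (p, 1) | c ≥ 0, p ∈ P} ⊆ ℝ^(d+1)`. -/
def cone (P : Set (Fin d → ℝ)) : Set (Fin (d + 1) → ℝ) :=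
  {x | ∃ c : ℝ, 0 ≤ c ∧ ∃ p ∈ P, x = c • lift p}

/-- The inclusion `ℤ^(d+1) ⊆ ℝ^(d+1)`. -/
def intPoint (z : Fin (d + 1) → ℤ) : Fin (d + 1) → ℝ :=
  fun i => (z i : ℝ)

/-- The lattice points of the cone over `P` whose last coordinate is `n`. -/
def latticePoints (P : Set (Fin d → ℝ)) (n : ℕ) : Set (Fin (d + 1) → ℤ) :=
  {z | intPoint z ∈ cone P ∧ z (Fin.last d) = (n : ℤ)}

/-- There are finitely many lattice points at each height, so that the sums below are honest. -/
theorem latticePoints_finite {P : Set (Fin d → ℝ)} (hP : IsRationalPolytope P) (n : ℕ) :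
    (latticePoints P n).Finite := by
  obtain ⟨V, rfl⟩ := hP
  have hb : Bornology.IsBounded (convexHull ℝ
      ((fun (v : Fin d → ℚ) (i : Fin d) => (v i : ℝ)) '' (V : Set (Fin d → ℚ)))) :=
    isBounded_convexHull.2 (V.finite_toSet.image _).isBounded
  obtain ⟨M, hM⟩ := hb.exists_norm_le
  have hfin : (Set.Icc (fun _ : Fin (d + 1) => -(⌈(n : ℝ) * max M 1⌉))
      (fun _ => ⌈(n : ℝ) * max M 1⌉)).Finite := Set.finite_Icc _ _
  refine hfin.subset ?_
  rintro z ⟨⟨c, hc, p, hp, hz⟩, hn⟩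
  have hcn : c = n := by
    have := congrFun hz (Fin.last d)
    simp only [intPoint, lift, Pi.smul_apply, Fin.snoc_last, smul_eq_mul, mul_one, hn] at this
    rw [← this]; simp
  have key : ∀ i, |(z i : ℝ)| ≤ (n : ℝ) * max M 1 := by
    intro i
    have h1 := congrFun hz i
    simp only [intPoint, Pi.smul_apply, smul_eq_mul] at h1
    rw [h1, abs_mul, abs_of_nonneg hc, hcn]
    refine mul_le_mul_of_nonneg_left ?_ (Nat.cast_nonneg n)
    refine Fin.lastCases ?_ (fun j => ?_) i
    · simp [lift]
    · simp only [lift, Fin.snoc_castSucc]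
      exact ((norm_le_pi_norm p j).trans (hM p hp)).trans (le_max_left _ _)
  constructor
  · intro i
    have h2 := (abs_le.1 (key i)).1
    have h3 := Int.le_ceil ((n : ℝ) * max M 1)
    have : ((-(⌈(n : ℝ) * max M 1⌉) : ℤ) : ℝ) ≤ (z i : ℝ) := by push_cast; linarith
    exact_mod_cast this
  · intro i
    have h2 := (abs_le.1 (key i)).2
    have h3 := Int.le_ceil ((n : ℝ) * max M 1)
    have : (z i : ℝ) ≤ ((⌈(n : ℝ) * max M 1⌉ : ℤ) : ℝ) := by linarith
    exact_mod_cast this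

/-- The weighted Ehrhart series `∑ w(x) t^(x_{d+1})`, the sum being over all
`x ∈ cone P ∩ ℤ^(d+1)`, as a formal power series in `t`. -/
def ehrhartSeries (P : Set (Fin d → ℝ)) (w : MvPolynomial (Fin (d + 1)) ℝ) : PowerSeries ℝ :=
  PowerSeries.mk fun n => ∑ᶠ z ∈ latticePoints P n, MvPolynomial.eval (intPoint z) w

/-- The exponent `dim P + deg w + 1` of `1 - t^q` in the rational form of the Ehrhart series. -/
def hStarExponent (P : Set (Fin d → ℝ)) (w : MvPolynomial (Fin (d + 1)) ℝ) : ℕ :=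
  dimension P + w.totalDegree + 1

/-- The weighted `h*`-polynomial of `P`: the numerator of
`Ehr(P, w; t) = h*(t) / (1 - t^q)^(r + m + 1)`, which is a polynomial of degree less than
`q (r + m + 1)`; here `q`, `r` are the denominator and dimension of `P`, and `m = deg w`.
The truncation only turns the power series `(1 - t^q)^(r + m + 1) Ehr(P, w; t)` into an element of
`ℝ[t]`; that nothing is cut off is part of what the theorem asserts. -/
def hStar (P : Set (Fin d → ℝ)) (w : MvPolynomial (Fin (d + 1)) ℝ) : Polynomial ℝ :=
  PowerSeries.trunc (denominator P * hStarExponent P w)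
    ((1 - PowerSeries.X ^ denominator P) ^ hStarExponent P w * ehrhartSeries P w)

/-- The linear form `∑ a_i x_i` in `d + 1` variables. -/
def linearForm (a : Fin (d + 1) → ℝ) : MvPolynomial (Fin (d + 1)) ℝ :=
  ∑ i, MvPolynomial.C (a i) * MvPolynomial.X i

/-- The dual cone: linear forms (given by their coefficients) that are nonnegative on the cone
over `P`. -/
def dualCone (P : Set (Fin d → ℝ)) : Set (Fin (d + 1) → ℝ) :=
  {a | ∀ x ∈ cone P, 0 ≤ MvPolynomial.eval x (linearForm a)}

/-- `R_P`: sums of products of linear forms in the dual cone, with nonnegative real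
coefficients. -/
def semiringR (P : Set (Fin d → ℝ)) : AddSubmonoid (MvPolynomial (Fin (d + 1)) ℝ) :=
  AddSubmonoid.closure
    {w | ∃ (c : ℝ) (k : ℕ) (a : Fin k → Fin (d + 1) → ℝ),
      0 ≤ c ∧ (∀ j, a j ∈ dualCone P) ∧ w = MvPolynomial.C c * ∏ j, linearForm (a j)}

/-- `S_P`: sums of products of (arbitrary) linear forms, each product being nonnegative on
`P` (identified with `P × {1}`), with nonnegative real coefficients. -/
def semiringS (P : Set (Fin d → ℝ)) : AddSubmonoid (MvPolynomial (Fin (d + 1)) ℝ) :=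
  AddSubmonoid.closure
    {w | ∃ (c : ℝ) (k : ℕ) (a : Fin k → Fin (d + 1) → ℝ),
      0 ≤ c ∧ (∀ p ∈ P, 0 ≤ MvPolynomial.eval (lift p) (∏ j, linearForm (a j))) ∧
        w = MvPolynomial.C c * ∏ j, linearForm (a j)}

end WeightedEhrhart

end

open scoped BigOperators

noncomputable section

namespace WeightedEhrhart

/-! The cone over `P` is cut into disjoint half-open simplicial cones spanned by lattice points `q
(v, 1)`, with `v` a vertex of `P`. Each of these cones has `r + 1` generators, all of height `q`, so
all the series share the denominator `(1 - t^q)^(r + m + 1)`. The numerators therefore add, and both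
positivity claims can be proved cone by cone.

In one cone with generators `v i`, every lattice point is uniquely `b + ∑ l i v i` with `l` a vector
of naturals and `b = ∑ x i v i` in the half-open parallelepiped, so `0 ≤ x i ≤ 1`. Put `W(y) = w(∑ y
i v i)`. The translates of `b` contribute `t^(height b)` times `∑ l, W(l + x) T^|l|` at `T = t^q`.
Monomial by monomial, this sum is a product of series `∑ n, (n + x)^a T^n`, whose numerators are the
polynomials `eulerPoly x a`.

For part 1, `eulerPoly x a` has nonnegative coefficients when `0 ≤ x ≤ 1`, by its coefficient
recursion. If `w ∈ R_P`, then so does `W`: a linear form pulls back to one whose coefficients are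
its values at the generators.

For part 2, only `W ≥ 0` on the orthant is available. For `T < 1` the numerator is a power of `1 -
T` times a convergent sum of nonnegative terms, and `T = 1` follows by continuity. For `T > 1`,
reversing the coefficients of `eulerPoly x a` gives `eulerPoly (1 - x) a`, which moves the question
to `1/T < 1` with `1 - x` again in `[0, 1]`.

The decomposition comes from linear programming. For a generic cost, the dual feasible bases are the
cells, and a point is assigned to the one cell that contains a small generic displacement of it in
its interior. Every half-open cone keeps at least one of its facets, so some `x i < 1`; this gives
the strict degree bound. -/

/-! ### Eulerian-type polynomials with a shift. -/

/-- The polynomials `A_a` with `∑ n, (n + x) ^ a T ^ n = A_a(T) / (1 - T) ^ (a + 1)`. -/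
def eulerPoly (x : ℝ) : ℕ → Polynomial ℝ
  | 0 => 1
  | a + 1 => Polynomial.C x * (1 - Polynomial.X) * eulerPoly x a +
      Polynomial.X * (1 - Polynomial.X) * Polynomial.derivative (eulerPoly x a) +
      Polynomial.C ((a : ℝ) + 1) * Polynomial.X * eulerPoly x a

theorem eulerPoly_coeff_zero (x : ℝ) (a : ℕ) :
    (eulerPoly x (a + 1)).coeff 0 = x * (eulerPoly x a).coeff 0 := by
  simp [eulerPoly, Polynomial.mul_coeff_zero]

theorem eulerPoly_coeff_succ (x : ℝ) (a j : ℕ) :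
    (eulerPoly x (a + 1)).coeff (j + 1) =
      (x + j + 1) * (eulerPoly x a).coeff (j + 1) +
        (a + 1 - j - x) * (eulerPoly x a).coeff j := by
  have h : eulerPoly x (a + 1) = Polynomial.C x * eulerPoly x a
      - Polynomial.C x * (eulerPoly x a * Polynomial.X)
      + Polynomial.derivative (eulerPoly x a) * Polynomial.X
      - Polynomial.derivative (eulerPoly x a) * Polynomial.X * Polynomial.X
      + Polynomial.C ((a : ℝ) + 1) * (eulerPoly x a * Polynomial.X) := by
    rw [eulerPoly]; ring
  rw [h]
  rcases j with _ | j
  · simp only [Polynomial.coeff_add, Polynomial.coeff_sub, Polynomial.coeff_C_mul,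
      Polynomial.coeff_mul_X, Polynomial.coeff_derivative, Polynomial.mul_coeff_zero,
      Polynomial.coeff_X_zero]
    push_cast; ring
  · simp only [Polynomial.coeff_add, Polynomial.coeff_sub, Polynomial.coeff_C_mul,
      Polynomial.coeff_mul_X, Polynomial.coeff_derivative]
    push_cast; ring

theorem eulerPoly_coeff_eq_zero (x : ℝ) {a : ℕ} : ∀ {j : ℕ}, a < j → (eulerPoly x a).coeff j = 0 := by
  induction a with
  | zero => intro j hj; simp [eulerPoly, Polynomial.coeff_one, hj.ne']
  | succ a ih =>
    intro j hj
    obtain ⟨j, rfl⟩ : ∃ i, j = i + 1 := ⟨j - 1, by omega⟩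
    rw [eulerPoly_coeff_succ, ih (by omega), ih (by omega)]; simp

theorem eulerPoly_natDegree_le (x : ℝ) (a : ℕ) : (eulerPoly x a).natDegree ≤ a :=
  Polynomial.natDegree_le_iff_coeff_eq_zero.2 fun _ h => eulerPoly_coeff_eq_zero x h

/-- The weights `x + j + 1` and `a + 1 - j - x` of the recursion are nonnegative for `j ≤ a`, and
for `j > a` the coefficient next to the second weight vanishes. -/
theorem eulerPoly_coeff_nonneg {x : ℝ} (h0 : 0 ≤ x) (h1 : x ≤ 1) (a : ℕ) :
    ∀ j, 0 ≤ (eulerPoly x a).coeff j := by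
  induction a with
  | zero => intro j; simp only [eulerPoly, Polynomial.coeff_one]; split_ifs <;> simp
  | succ a ih =>
    rintro (_ | j)
    · rw [eulerPoly_coeff_zero]; exact mul_nonneg h0 (ih 0)
    · rw [eulerPoly_coeff_succ]
      refine add_nonneg (mul_nonneg (by positivity) (ih _)) ?_
      rcases lt_or_ge a j with h | h
      · simp [eulerPoly_coeff_eq_zero x h]
      · have : (j : ℝ) ≤ a := by exact_mod_cast h
        exact mul_nonneg (by linarith) (ih _)

/-- The coefficient recursion is invariant under reversing the indices and exchanging `x` with `1 -
x`. -/
theorem eulerPoly_coeff_symm (x : ℝ) (a : ℕ) :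
    ∀ i j, i + j = a → (eulerPoly (1 - x) a).coeff j = (eulerPoly x a).coeff i := by
  induction a with
  | zero =>
    intro i j h
    obtain ⟨rfl, rfl⟩ : i = 0 ∧ j = 0 := by omega
    simp [eulerPoly]
  | succ a ih =>
    rintro (_ | i) (_ | j) h
    · omega
    · obtain rfl : j = a := by omega
      rw [eulerPoly_coeff_succ, eulerPoly_coeff_zero, eulerPoly_coeff_eq_zero _ (Nat.lt_succ_self j),
        ih 0 j (by omega)]
      ring
    · obtain rfl : i = a := by omega
      rw [eulerPoly_coeff_succ, eulerPoly_coeff_zero, eulerPoly_coeff_eq_zero _ (Nat.lt_succ_self i),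
        ih i 0 (by omega)]
      ring
    · obtain rfl : a = i + j + 1 := by omega
      rw [eulerPoly_coeff_succ (1 - x) (i + j + 1) j, eulerPoly_coeff_succ x (i + j + 1) i,
        ih i (j + 1) (by omega), ih (i + 1) j (by omega)]
      push_cast; ring

theorem eulerPoly_one_sub_eval (x : ℝ) (a : ℕ) {t : ℝ} (ht : t ≠ 0) :
    (eulerPoly x a).eval t = t ^ a * (eulerPoly (1 - x) a).eval t⁻¹ := by
  have h : eulerPoly (1 - x) a = Polynomial.reflect a (eulerPoly x a) := by
    ext j
    rw [Polynomial.coeff_reflect]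
    rcases le_or_gt j a with h | h
    · rw [Polynomial.revAt_le h]
      exact eulerPoly_coeff_symm x a _ _ (by omega)
    · rw [Polynomial.revAt_eq_self_of_lt h, eulerPoly_coeff_eq_zero _ h,
        eulerPoly_coeff_eq_zero _ h]
  let _ : Invertible t := invertibleOfNonzero ht
  have := Polynomial.eval₂_reflect_mul_pow (RingHom.id ℝ) t a (eulerPoly x a)
    (eulerPoly_natDegree_le x a)
  rw [h, mul_comm, Polynomial.eval, Polynomial.eval, ← this, invOf_eq_inv]

/-- The power series `∑ n, (n + x) ^ a T ^ n`. -/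
def powerSum (x : ℝ) (a : ℕ) : PowerSeries ℝ := PowerSeries.mk fun n => ((n : ℝ) + x) ^ a

theorem powerSum_succ (x : ℝ) (a : ℕ) :
    powerSum x (a + 1) = PowerSeries.C x * powerSum x a +
      PowerSeries.X * PowerSeries.derivative ℝ (powerSum x a) := by
  ext n
  rcases n with _ | n
  · simp [powerSum, pow_succ']
  · simp only [powerSum, PowerSeries.coeff_mk, map_add, PowerSeries.coeff_C_mul,
      PowerSeries.coeff_succ_X_mul, PowerSeries.coeff_derivative]
    push_cast; ring

/-- Multiplying the `n`-th term by `n + x` is the operator `x + T d/dT`. Applied to `A_a / (1 -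
T)^(a + 1)`, it yields the recursion that defines `eulerPoly`. -/
theorem one_sub_pow_mul_powerSum (x : ℝ) (a : ℕ) :
    (1 - PowerSeries.X) ^ (a + 1) * powerSum x a = (eulerPoly x a : PowerSeries ℝ) := by
  induction a with
  | zero =>
    have := PowerSeries.mk_one_mul_one_sub_eq_one ℝ
    simp only [powerSum, pow_zero, eulerPoly, Polynomial.coe_one, zero_add, pow_one]
    rw [mul_comm]; exact this
  | succ a ih =>
    have hd := congrArg (PowerSeries.derivative ℝ) ih
    rw [PowerSeries.derivative_coe] at hd
    simp only [Derivation.leibniz, Derivation.leibniz_pow, map_sub, smul_eq_mul, nsmul_eq_mul,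
      PowerSeries.derivative_X, Derivation.map_one_eq_zero, add_tsub_cancel_right] at hd
    have hC : (PowerSeries.C ((a : ℝ) + 1) : PowerSeries ℝ) = (a : PowerSeries ℝ) + 1 := by simp
    rw [powerSum_succ, eulerPoly]
    simp only [Polynomial.coe_add, Polynomial.coe_mul, Polynomial.coe_C, Polynomial.coe_X,
      Polynomial.coe_sub, Polynomial.coe_one, ← ih, ← hd, hC]
    push_cast; ring

/-! ### Weighted sums over a shifted orthant. -/

section Numerator

variable {κ : Type*} [Fintype κ]

/-- The numerator of the series `∑ l, W(l + x) T ^ |l|`, the sum being over `l ∈ ℕ ^ κ`. -/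
def orthantNum (x : κ → ℝ) (W : MvPolynomial κ ℝ) : Polynomial ℝ :=
  ∑ a ∈ W.support, Polynomial.C (W.coeff a) * ∏ i, eulerPoly (x i) (a i)

/-- The series `∑ l, W(l + x) T ^ |l|`, the sum being over `l ∈ ℕ ^ κ`. -/
def orthantSeries [DecidableEq κ] (x : κ → ℝ) (W : MvPolynomial κ ℝ) : PowerSeries ℝ :=
  PowerSeries.mk fun n => ∑ l ∈ Finset.finsuppAntidiag (Finset.univ : Finset κ) n,
    MvPolynomial.eval (fun i => (l i : ℝ) + x i) W

theorem orthantSeries_eq_sum [DecidableEq κ] (x : κ → ℝ) (W : MvPolynomial κ ℝ) :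
    orthantSeries x W =
      ∑ a ∈ W.support, PowerSeries.C (W.coeff a) * ∏ i, powerSum (x i) (a i) := by
  ext n
  simp only [orthantSeries, PowerSeries.coeff_mk, map_sum, PowerSeries.coeff_C_mul,
    PowerSeries.coeff_prod, powerSum, MvPolynomial.eval_eq']
  rw [Finset.sum_comm]
  simp only [Finset.mul_sum]

theorem sum_eq_of_isHomogeneous {W : MvPolynomial κ ℝ} {m : ℕ} (hW : W.IsHomogeneous m)
    {a : κ →₀ ℕ} (ha : a ∈ W.support) : ∑ i, a i = m := by
  have := hW (MvPolynomial.mem_support_iff.1 ha)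
  rw [Finsupp.weight_apply, Finsupp.sum_fintype _ _ (by simp)] at this
  simpa using this

theorem one_sub_pow_mul_orthantSeries [DecidableEq κ] (x : κ → ℝ) {W : MvPolynomial κ ℝ} {m : ℕ}
    (hW : W.IsHomogeneous m) :
    (1 - PowerSeries.X) ^ (Fintype.card κ + m) * orthantSeries x W =
      (orthantNum x W : PowerSeries ℝ) := by
  rw [orthantSeries_eq_sum, orthantNum, ← Polynomial.coeToPowerSeries.ringHom_apply, map_sum,
    Finset.mul_sum]
  refine Finset.sum_congr rfl fun a ha => ?_
  rw [map_mul, map_prod]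
  simp only [Polynomial.coeToPowerSeries.ringHom_apply, Polynomial.coe_C,
    ← one_sub_pow_mul_powerSum]
  rw [Finset.prod_mul_distrib, Finset.prod_pow_eq_pow_sum, Finset.sum_add_distrib,
    sum_eq_of_isHomogeneous hW ha]
  simp only [Finset.sum_const, Finset.card_univ, smul_eq_mul, mul_one]
  rw [add_comm m]; ring

theorem orthantNum_natDegree_le (x : κ → ℝ) {W : MvPolynomial κ ℝ} {m : ℕ}
    (hW : W.IsHomogeneous m) : (orthantNum x W).natDegree ≤ m := by
  refine Polynomial.natDegree_sum_le_of_forall_le _ _ fun a ha => ?_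
  refine (Polynomial.natDegree_C_mul_le _ _).trans ?_
  refine (Polynomial.natDegree_prod_le _ _).trans ?_
  rw [← sum_eq_of_isHomogeneous hW ha]
  exact Finset.sum_le_sum fun i _ => eulerPoly_natDegree_le _ _

theorem coeff_mul_nonneg {p q : Polynomial ℝ} (hp : ∀ n, 0 ≤ p.coeff n)
    (hq : ∀ n, 0 ≤ q.coeff n) (n : ℕ) : 0 ≤ (p * q).coeff n := by
  rw [Polynomial.coeff_mul]
  exact Finset.sum_nonneg fun _ _ => mul_nonneg (hp _) (hq _)

theorem coeff_prod_nonneg {α : Type*} (s : Finset α) {p : α → Polynomial ℝ}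
    (hp : ∀ i ∈ s, ∀ n, 0 ≤ (p i).coeff n) : ∀ n, 0 ≤ (∏ i ∈ s, p i).coeff n := by
  refine Finset.prod_induction p (fun r => ∀ n, 0 ≤ r.coeff n) (fun _ _ => coeff_mul_nonneg) ?_ hp
  intro n; rw [Polynomial.coeff_one]; split_ifs <;> simp

theorem orthantNum_coeff_nonneg {x : κ → ℝ} (h0 : ∀ i, 0 ≤ x i) (h1 : ∀ i, x i ≤ 1)
    {W : MvPolynomial κ ℝ} (hW : ∀ a, 0 ≤ W.coeff a) (n : ℕ) : 0 ≤ (orthantNum x W).coeff n := by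
  rw [orthantNum, Polynomial.finsetSum_coeff]
  refine Finset.sum_nonneg fun a _ => ?_
  rw [Polynomial.coeff_C_mul]
  exact mul_nonneg (hW a) (coeff_prod_nonneg _
    (fun i _ => eulerPoly_coeff_nonneg (h0 i) (h1 i) _) n)

theorem orthantNum_one_sub_eval (x : κ → ℝ) {W : MvPolynomial κ ℝ} {m : ℕ}
    (hW : W.IsHomogeneous m) {t : ℝ} (ht : t ≠ 0) :
    (orthantNum x W).eval t = t ^ m * (orthantNum (fun i => 1 - x i) W).eval t⁻¹ := by
  simp only [orthantNum, Polynomial.eval_finsetSum, Finset.mul_sum, Polynomial.eval_mul,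
    Polynomial.eval_C, Polynomial.eval_prod]
  refine Finset.sum_congr rfl fun a ha => ?_
  simp only [eulerPoly_one_sub_eval (x _) _ ht]
  rw [Finset.prod_mul_distrib, Finset.prod_pow_eq_pow_sum, sum_eq_of_isHomogeneous hW ha]
  ring

/-- Dividing by `1 - T` is a Cauchy product with the geometric series; this form lets the product of
absolutely convergent series be quoted. -/
theorem coeff_mul_pow_of_one_sub_mul {S R : PowerSeries ℝ} (h : (1 - PowerSeries.X) * R = S)
    (t : ℝ) (n : ℕ) : R.coeff n * t ^ n =
      ∑ kl ∈ Finset.HasAntidiagonal.antidiagonal n, t ^ kl.1 * (S.coeff kl.2 * t ^ kl.2) := by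
  have hR : R = PowerSeries.mk 1 * S := by
    rw [← h, ← mul_assoc, PowerSeries.mk_one_mul_one_sub_eq_one, one_mul]
  rw [hR, PowerSeries.coeff_mul, Finset.sum_mul]
  refine Finset.sum_congr rfl fun kl hkl => ?_
  rw [← Finset.HasAntidiagonal.mem_antidiagonal.1 hkl, pow_add, PowerSeries.coeff_mk, Pi.one_apply]
  ring

/-- If `S` converges absolutely at `t ∈ [0, 1)`, then so does `S / (1 - T)`. -/
theorem summable_of_one_sub_mul {S R : PowerSeries ℝ} (h : (1 - PowerSeries.X) * R = S) {t : ℝ}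
    (h0 : 0 ≤ t) (h1 : t < 1) (hS : Summable fun n => ‖S.coeff n * t ^ n‖) :
    (Summable fun n => ‖R.coeff n * t ^ n‖) ∧
      (1 - t) * ∑' n, R.coeff n * t ^ n = ∑' n, S.coeff n * t ^ n := by
  have hg : Summable fun n : ℕ => ‖t ^ n‖ := by
    simpa [abs_of_nonneg h0] using summable_geometric_of_lt_one h0 h1
  have hs := summable_norm_sum_mul_antidiagonal_of_summable_norm hg hS
  have ht := tsum_mul_tsum_eq_tsum_sum_antidiagonal_of_summable_norm hg hS
  simp only [← coeff_mul_pow_of_one_sub_mul h t] at hs ht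
  refine ⟨hs, ?_⟩
  rw [← ht, tsum_geometric_of_lt_one h0 h1, ← mul_assoc, mul_inv_cancel₀ (by linarith), one_mul]

theorem summable_of_one_sub_pow_mul {p : Polynomial ℝ} {t : ℝ} (h0 : 0 ≤ t) (h1 : t < 1) (N : ℕ) :
    ∀ R : PowerSeries ℝ, (1 - PowerSeries.X) ^ N * R = (p : PowerSeries ℝ) →
    (Summable fun n => ‖R.coeff n * t ^ n‖) ∧
      (1 - t) ^ N * ∑' n, R.coeff n * t ^ n = p.eval t := by
  induction N with
  | zero =>
    intro R h
    rw [pow_zero, one_mul] at h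
    have hz : ∀ n ∉ Finset.range (p.natDegree + 1), p.coeff n * t ^ n = 0 := by
      intro n hn
      rw [Polynomial.coeff_eq_zero_of_natDegree_lt (by simpa using hn), zero_mul]
    simp only [h, Polynomial.coeff_coe]
    refine ⟨summable_of_ne_finset_zero (s := Finset.range (p.natDegree + 1))
      fun n hn => by rw [hz n hn, norm_zero], ?_⟩
    rw [tsum_eq_sum hz, pow_zero, one_mul, Polynomial.eval_eq_sum_range]
  | succ N ih =>
    intro R h
    obtain ⟨hs, he⟩ := ih ((1 - PowerSeries.X) * R) (by rw [← h]; ring)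
    obtain ⟨hs', he'⟩ := summable_of_one_sub_mul rfl h0 h1 hs
    exact ⟨hs', by rw [← he, ← he']; ring⟩

theorem orthantNum_eval_nonneg_of_lt_one {x : κ → ℝ} (h0 : ∀ i, 0 ≤ x i)
    {W : MvPolynomial κ ℝ} {m : ℕ} (hW : W.IsHomogeneous m)
    (hpos : ∀ y : κ → ℝ, (∀ i, 0 ≤ y i) → 0 ≤ MvPolynomial.eval y W) {t : ℝ} (ht : 0 ≤ t)
    (ht1 : t < 1) : 0 ≤ (orthantNum x W).eval t := by
  classical
  obtain ⟨-, h⟩ := summable_of_one_sub_pow_mul ht ht1 _ _ (one_sub_pow_mul_orthantSeries x hW)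
  rw [← h]
  refine mul_nonneg (pow_nonneg (by linarith) _) (tsum_nonneg fun n => mul_nonneg ?_ (by positivity))
  rw [orthantSeries, PowerSeries.coeff_mk]
  exact Finset.sum_nonneg fun l _ => hpos _ fun i => add_nonneg (Nat.cast_nonneg _) (h0 i)

theorem orthantNum_eval_nonneg {x : κ → ℝ} (h0 : ∀ i, 0 ≤ x i) (h1 : ∀ i, x i ≤ 1)
    {W : MvPolynomial κ ℝ} {m : ℕ} (hW : W.IsHomogeneous m)
    (hpos : ∀ y : κ → ℝ, (∀ i, 0 ≤ y i) → 0 ≤ MvPolynomial.eval y W) {t : ℝ} (ht : 0 ≤ t) :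
    0 ≤ (orthantNum x W).eval t := by
  rcases lt_trichotomy t 1 with h | rfl | h
  · exact orthantNum_eval_nonneg_of_lt_one h0 hW hpos ht h
  · have hc : Filter.Tendsto (fun s => (orthantNum x W).eval s) (nhdsWithin 1 (Set.Iio 1))
        (nhds ((orthantNum x W).eval 1)) :=
      (orthantNum x W).continuous.continuousAt.tendsto.mono_left nhdsWithin_le_nhds
    refine ge_of_tendsto hc ?_
    filter_upwards [Ioo_mem_nhdsLT (zero_lt_one (α := ℝ))] with s hs
    exact orthantNum_eval_nonneg_of_lt_one h0 hW hpos hs.1.le hs.2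
  -- Only here is `x i ≤ 1` needed: the shift becomes `1 - x`, which must be nonnegative for the
  -- case `t⁻¹ < 1`.
  · rw [orthantNum_one_sub_eval x hW (by linarith)]
    exact mul_nonneg (pow_nonneg ht _) (orthantNum_eval_nonneg_of_lt_one
      (fun i => by linarith [h1 i]) hW hpos (inv_nonneg.2 ht) (inv_lt_one_of_one_lt₀ h))

end Numerator

/-! ### Half-open triangulation of a cone by linear programming. -/

section Triangulation

variable {ι : Type*} {E : Type*} [AddCommGroup E] [Module ℝ E]

/-- The vectors `g i`, `i ∈ s`, form a basis of the span of all `g i`. -/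
def IsBasisSet (g : ι → E) (s : Finset ι) : Prop :=
  LinearIndepOn ℝ g (s : Set ι) ∧ ∀ j, g j ∈ Submodule.span ℝ (g '' (s : Set ι))

/-- Coordinates with respect to `s`, padded by zeros outside `s` and extended linearly beyond the
span. Being defined on all of `E`, they can be compared between different bases. -/
theorem exists_coord [DecidableEq ι] {g : ι → E} {s : Finset ι}
    (hs : LinearIndepOn ℝ g (s : Set ι)) :
    ∃ Φ : E →ₗ[ℝ] (ι → ℝ), ∀ j ∈ s, Φ (g j) = Pi.single j 1 := by
  have hs' : LinearIndependent ℝ (fun i : (s : Set ι) => g i) := hs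
  obtain ⟨L, hL⟩ := LinearMap.exists_leftInverse_of_injective
    (Finsupp.linearCombination ℝ (fun i : (s : Set ι) => g i)) (LinearMap.ker_eq_bot.2 hs')
  refine ⟨Finsupp.lcoeFun ∘ₗ Finsupp.lmapDomain ℝ ℝ (fun i : (s : Set ι) => (i : ι)) ∘ₗ L,
    fun j hj => ?_⟩
  have h1 := LinearMap.congr_fun hL (Finsupp.single (⟨j, hj⟩ : (s : Set ι)) 1)
  simp only [LinearMap.comp_apply, Finsupp.linearCombination_single, one_smul,
    LinearMap.id_apply] at h1
  simp only [LinearMap.comp_apply, h1, Finsupp.lmapDomain_apply, Finsupp.mapDomain_single]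
  ext i
  simp [Finsupp.lcoeFun, Finsupp.single_apply, Pi.single_apply, eq_comm]

variable {g : ι → E} {s : Finset ι} {Φ : E →ₗ[ℝ] (ι → ℝ)}

theorem coord_apply_of_notMem [DecidableEq ι] (hΦ : ∀ j ∈ s, Φ (g j) = Pi.single j 1) {x : E}
    (hx : x ∈ Submodule.span ℝ (g '' (s : Set ι))) {i : ι} (hi : i ∉ s) : Φ x i = 0 := by
  induction hx using Submodule.span_induction with
  | mem x hx =>
    obtain ⟨j, hj, rfl⟩ := hx
    rw [hΦ j hj, Pi.single_eq_of_ne]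
    rintro rfl; exact hi hj
  | zero => simp
  | add x y _ _ hx hy => simp [hx, hy]
  | smul a x _ hx => simp [hx]

theorem IsBasisSet.eq_of_subset [DecidableEq ι] {t : Finset ι} (hs : IsBasisSet g s) (ht : IsBasisSet g t)
    (hst : s ⊆ t) : s = t := by
  obtain ⟨Φ, hΦ⟩ := exists_coord ht.1
  refine hst.antisymm fun j hj => ?_
  by_contra hjs
  have := coord_apply_of_notMem (fun i hi => hΦ i (hst hi)) (hs.2 j) hjs
  rw [hΦ j hj, Pi.single_eq_same] at this
  exact one_ne_zero this

variable [Fintype ι]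

theorem sum_coord_smul [DecidableEq ι] (hΦ : ∀ j ∈ s, Φ (g j) = Pi.single j 1) {x : E}
    (hx : x ∈ Submodule.span ℝ (g '' (s : Set ι))) : ∑ i, Φ x i • g i = x := by
  induction hx using Submodule.span_induction with
  | mem x hx =>
    obtain ⟨j, hj, rfl⟩ := hx
    rw [hΦ j hj]
    simp [Pi.single_apply, ite_smul]
  | zero => simp
  | add x y _ _ hx hy => simp [add_smul, Finset.sum_add_distrib, hx, hy]
  | smul a x _ hx => simp [mul_smul, ← Finset.smul_sum, hx]

theorem coord_sum_smul [DecidableEq ι] (hΦ : ∀ j ∈ s, Φ (g j) = Pi.single j 1) {μ : ι → ℝ}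
    (hμ : ∀ i, i ∉ s → μ i = 0) : Φ (∑ i, μ i • g i) = μ := by
  rw [map_sum, ← Finset.sum_subset (Finset.subset_univ s)
    (fun i _ hi => by rw [hμ i hi, zero_smul, map_zero]),
    Finset.sum_congr rfl fun i hi => by rw [map_smul, hΦ i hi]]
  ext i
  rw [Finset.sum_apply]
  by_cases hi : i ∈ s
  · simp [Pi.single_apply, hi]
  · simp [Pi.single_apply, hi, hμ i hi]

theorem IsBasisSet.sum_mem (hs : IsBasisSet g s) (μ : ι → ℝ) :
    ∑ i, μ i • g i ∈ Submodule.span ℝ (g '' (s : Set ι)) :=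
  Submodule.sum_mem _ fun i _ => Submodule.smul_mem _ _ (hs.2 i)

theorem exists_isBasisSet_superset (t : Finset ι) (ht : LinearIndepOn ℝ g (t : Set ι)) :
    ∃ s, t ⊆ s ∧ IsBasisSet g s := by
  obtain ⟨b, -, hb, hspan, hli⟩ := exists_linearIndepOn_extension ht (Set.subset_univ _)
  classical
  refine ⟨b.toFinite.toFinset, fun i hi => by simpa using hb hi, by simpa using hli, fun j => ?_⟩
  simpa using hspan ⟨j, trivial, rfl⟩

/-- The half-open simplicial cone `{∑ ν i g i | ν ≥ 0, ν > 0 on I, ν = 0 off s}`. -/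
def halfOpenCone (g : ι → E) (s I : Finset ι) : Set E :=
  {x | ∃ ν : ι → ℝ, (∀ i, 0 ≤ ν i) ∧ (∀ i ∈ I, 0 < ν i) ∧ (∀ i, i ∉ s → ν i = 0) ∧
    ∑ i, ν i • g i = x}

/-- `μ` is an optimal solution of the linear program `min c · μ`, `μ ≥ 0`, `∑ μ i g i = y`. -/
def IsOptimal (g : ι → E) (c : ι → ℝ) (y : E) (μ : ι → ℝ) : Prop :=
  (∀ i, 0 ≤ μ i) ∧ ∑ i, μ i • g i = y ∧
    ∀ ν : ι → ℝ, (∀ i, 0 ≤ ν i) → ∑ i, ν i • g i = y → ∑ i, c i * μ i ≤ ∑ i, c i * ν i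

/-- Moving from `μ` along `ν` stays feasible for a short time, so the cost cannot decrease in that
direction. -/
theorem IsOptimal.sum_nonneg {c : ι → ℝ} {y : E} {μ : ι → ℝ} (h : IsOptimal g c y μ)
    {ν : ι → ℝ} (hν : ∑ i, ν i • g i = 0) (hpos : ∀ i, μ i = 0 → 0 ≤ ν i) :
    0 ≤ ∑ i, c i * ν i := by
  have hev : ∀ᶠ ε : ℝ in nhdsWithin 0 (Set.Ioi 0), ∀ i, 0 ≤ μ i + ε * ν i := by
    rw [Filter.eventually_all]
    intro i
    rcases (h.1 i).eq_or_lt with h0 | h0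
    · filter_upwards [self_mem_nhdsWithin] with ε hε
      rw [← h0, zero_add]
      exact mul_nonneg (le_of_lt hε) (hpos i h0.symm)
    · have : Filter.Tendsto (fun ε : ℝ => μ i + ε * ν i) (nhdsWithin 0 (Set.Ioi 0))
          (nhds (μ i + 0 * ν i)) :=
        (Continuous.tendsto (by fun_prop) 0).mono_left nhdsWithin_le_nhds
      rw [zero_mul, add_zero] at this
      filter_upwards [this.eventually (lt_mem_nhds h0)] with ε hε using le_of_lt hε
  obtain ⟨ε, hε, hpos⟩ := (hev.and self_mem_nhdsWithin).exists
  have h1 := h.2.2 (fun i => μ i + ε * ν i) hε (by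
    simp only [add_smul, mul_smul, Finset.sum_add_distrib, ← Finset.smul_sum, hν, h.2.1,
      smul_zero, add_zero])
  have h2 : ∑ i, c i * (μ i + ε * ν i) = ∑ i, c i * μ i + ε * ∑ i, c i * ν i := by
    rw [Finset.mul_sum, ← Finset.sum_add_distrib]
    exact Finset.sum_congr rfl fun i _ => by ring
  rw [h2] at h1
  have h3 : 0 ≤ ε * ∑ i, c i * ν i := by linarith
  exact nonneg_of_mul_nonneg_right h3 hpos

/-- Positivity of `h` on the generators bounds each coordinate of a feasible point by `h y / h (g
i)`, so the feasible set is compact. -/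
theorem exists_isOptimal {n : ℕ} {g : ι → Fin n → ℝ} (h : (Fin n → ℝ) →ₗ[ℝ] ℝ)
    (hg : ∀ i, 0 < h (g i)) (c μ : ι → ℝ) (hμ : ∀ i, 0 ≤ μ i) :
    ∃ μ', IsOptimal g c (∑ i, μ i • g i) μ' := by
  set y := ∑ i, μ i • g i with hy
  let K : Set (ι → ℝ) := {ν | (∀ i, 0 ≤ ν i) ∧ ∑ i, ν i • g i = y}
  have hclosed : IsClosed K := by
    have hK : K = Set.Ici 0 ∩ {ν | ∑ i, ν i • g i = y} := rfl
    rw [hK]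
    exact isClosed_Ici.inter (isClosed_eq (by fun_prop) continuous_const)
  have hsub : K ⊆ Set.Icc 0 (fun i => h y / h (g i)) := by
    rintro ν ⟨h0, h1⟩
    refine ⟨h0, fun i => ?_⟩
    rw [le_div_iff₀ (hg i), ← h1, map_sum]
    simp only [map_smul, smul_eq_mul]
    exact Finset.single_le_sum (f := fun i => ν i * h (g i))
      (fun j _ => mul_nonneg (h0 j) (hg j).le) (Finset.mem_univ i)
  have hK : IsCompact K := isCompact_Icc.of_isClosed_subset hclosed hsub
  obtain ⟨μ', hμ', hmin⟩ := hK.exists_isMinOn ⟨μ, hμ, hy.symm⟩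
    (f := fun ν => ∑ i, c i * ν i) (Continuous.continuousOn (by fun_prop))
  exact ⟨μ', hμ'.1, hμ'.2, fun ν h0 h1 => hmin ⟨h0, h1⟩⟩

theorem sum_single_sub_smul [DecidableEq ι] (hs : IsBasisSet g s) (hΦ : ∀ j ∈ s, Φ (g j) = Pi.single j 1) (j : ι) :
    ∑ i, (Pi.single j 1 - Φ (g j) : ι → ℝ) i • g i = 0 := by
  simp only [Pi.sub_apply, sub_smul, Finset.sum_sub_distrib, sum_coord_smul hΦ (hs.2 j)]
  simp [Pi.single_apply, ite_smul]

/-- A cost vector is generic if no reduced cost with respect to a basis vanishes. -/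
def IsGenericCost [DecidableEq ι] (g : ι → E) (Φ : Finset ι → E →ₗ[ℝ] (ι → ℝ)) (c : ι → ℝ) : Prop :=
  ∀ s, IsBasisSet g s → ∀ j, j ∉ s → ∑ i, c i * (Pi.single j 1 - Φ s (g j) : ι → ℝ) i ≠ 0

/-- The support of an optimal solution of a generic linear program is linearly independent. -/
theorem IsOptimal.linearIndepOn [DecidableEq ι] {Φ : Finset ι → E →ₗ[ℝ] (ι → ℝ)}
    (hΦ : ∀ s, IsBasisSet g s → ∀ j ∈ s, Φ s (g j) = Pi.single j 1) {c : ι → ℝ}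
    (hc : IsGenericCost g Φ c) {y : E} {μ : ι → ℝ} (h : IsOptimal g c y μ) :
    LinearIndepOn ℝ g {i | μ i ≠ 0} := by
  -- Take a maximal independent part `b` of the support. A further support element `j` gives a
  -- relation supported inside the support of `μ`, which can be followed in both directions; its
  -- reduced cost is then zero, against genericity.
  obtain ⟨b, hbS, -, hspan, hli⟩ := exists_linearIndepOn_extension
    (linearIndepOn_empty ℝ g) (Set.empty_subset {i | μ i ≠ 0})
  suffices {i | μ i ≠ 0} ⊆ b from hli.mono this
  intro j hj
  by_contra hjb
  obtain ⟨s, hbs, hs⟩ := exists_isBasisSet_superset b.toFinite.toFinset (by simpa using hli)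
  replace hbs : b ⊆ s := fun i hi => hbs (by simpa using hi)
  have hjspan : g j ∈ Submodule.span ℝ (g '' (b.toFinite.toFinset : Set ι)) := by
    simpa using hspan ⟨j, hj, rfl⟩
  have hzero : ∀ i, i ∉ b → Φ s (g j) i = 0 := fun i hi =>
    coord_apply_of_notMem (s := b.toFinite.toFinset)
      (fun j hj => hΦ s hs j (hbs (by simpa using hj))) hjspan (by simpa using hi)
  have hjs : j ∉ s := by
    intro hjs
    have := hzero j hjb
    rw [hΦ s hs j hjs] at this
    simp at this
  have hsupp : ∀ i, μ i = 0 → (Pi.single j 1 - Φ s (g j) : ι → ℝ) i = 0 := by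
    intro i hi
    have h1 : i ≠ j := by rintro rfl; exact hj hi
    have h2 : i ∉ b := fun hb => hbS hb hi
    simp [h1, hzero i h2]
  have hν := sum_single_sub_smul hs (hΦ s hs) j
  have h1 := h.sum_nonneg hν fun i hi => (hsupp i hi).ge
  have h2 := h.sum_nonneg (ν := -(Pi.single j 1 - Φ s (g j)))
    (by simpa only [Pi.neg_apply, neg_smul, Finset.sum_neg_distrib, neg_eq_zero] using hν)
    fun i hi => by rw [Pi.neg_apply, hsupp i hi, neg_zero]
  simp only [Pi.neg_apply, mul_neg, Finset.sum_neg_distrib] at h2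
  exact hc s hs j hjs (le_antisymm (by linarith) h1)

/-- The bases that are dual feasible for the cost vector `c`: the maximal cells of a regular
triangulation. -/
def IsCell [DecidableEq ι] (g : ι → E) (Φ : Finset ι → E →ₗ[ℝ] (ι → ℝ)) (c : ι → ℝ) (s : Finset ι) : Prop :=
  IsBasisSet g s ∧ ∀ j, j ∉ s → 0 < ∑ i, c i * (Pi.single j 1 - Φ s (g j) : ι → ℝ) i

/-- An optimal solution has independent support, hence is the coordinate vector of the point in some
basis `s`. As no coordinate vanishes there, its support is all of `s`; optimality then makes the
reduced costs nonnegative, and genericity makes them positive. -/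
theorem exists_isCell [DecidableEq ι] {n : ℕ} {g : ι → Fin n → ℝ} (h : (Fin n → ℝ) →ₗ[ℝ] ℝ)
    (hg : ∀ i, 0 < h (g i)) {Φ : Finset ι → (Fin n → ℝ) →ₗ[ℝ] (ι → ℝ)}
    (hΦ : ∀ s, IsBasisSet g s → ∀ j ∈ s, Φ s (g j) = Pi.single j 1) {c : ι → ℝ}
    (hc : IsGenericCost g Φ c) {μ : ι → ℝ} (hμ : ∀ i, 0 ≤ μ i)
    (hgen : ∀ s, IsBasisSet g s → ∀ i ∈ s, Φ s (∑ i, μ i • g i) i ≠ 0) :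
    ∃ s, IsCell g Φ c s ∧ ∀ i ∈ s, 0 < Φ s (∑ i, μ i • g i) i := by
  obtain ⟨ν, hν⟩ := exists_isOptimal h hg c μ hμ
  have hli := hν.linearIndepOn hΦ hc
  obtain ⟨s, hsub, hs⟩ := exists_isBasisSet_superset ({i | ν i ≠ 0} : Finset ι) (by simpa using hli)
  have hcoord : Φ s (∑ i, μ i • g i) = ν := by
    rw [← hν.2.1]
    refine coord_sum_smul (hΦ s hs) fun i hi => ?_
    by_contra h0
    exact hi (hsub (by simpa using h0))
  have hpos : ∀ i ∈ s, 0 < ν i := fun i hi =>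
    lt_of_le_of_ne (hν.1 i) (Ne.symm (by have := hgen s hs i hi; rwa [hcoord] at this))
  refine ⟨s, ⟨hs, fun j hj => lt_of_le_of_ne ?_ (hc s hs j hj).symm⟩, by rwa [hcoord]⟩
  refine hν.sum_nonneg (sum_single_sub_smul hs (hΦ s hs) j) fun i hi => ?_
  have his : i ∉ s := fun his => (hpos i his).ne' hi
  rw [Pi.sub_apply, coord_apply_of_notMem (hΦ s hs) (hs.2 j) his, sub_zero]
  rw [Pi.single_apply]; split_ifs <;> simp

/-- The cost measured in the cell `t` is a linear functional with value at most `c j` on `g j`,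
strictly less for `j ∉ t`. If `s` used such a `j`, the expression of `y` in `t` would be strictly
cheaper than the one in `s`. -/
theorem IsCell.subset [DecidableEq ι] {Φ : Finset ι → E →ₗ[ℝ] (ι → ℝ)}
    (hΦ : ∀ s, IsBasisSet g s → ∀ j ∈ s, Φ s (g j) = Pi.single j 1) {c : ι → ℝ} {s t : Finset ι}
    (hs : IsCell g Φ c s) (ht : IsCell g Φ c t) {y : E}
    (hy : y ∈ Submodule.span ℝ (g '' (s : Set ι))) (hpos : ∀ i ∈ s, 0 < Φ s y i)
    (hle : ∑ i, c i * Φ s y i ≤ ∑ i, c i * Φ t y i) : s ⊆ t := by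
  have key : ∀ j, ∑ i, c i * Φ t (g j) i ≤ c j := by
    intro j
    by_cases hj : j ∈ t
    · rw [hΦ t ht.1 j hj]; simp [Pi.single_apply]
    · have := ht.2 j hj
      simp only [Pi.sub_apply, mul_sub, Finset.sum_sub_distrib] at this
      simp [Pi.single_apply] at this
      linarith
  have hexp : ∑ i, c i * Φ t y i = ∑ j, Φ s y j * ∑ i, c i * Φ t (g j) i := by
    conv_lhs => rw [← sum_coord_smul (hΦ s hs.1) hy]
    simp only [map_sum, map_smul, Finset.sum_apply, Pi.smul_apply, smul_eq_mul, Finset.mul_sum]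
    rw [Finset.sum_comm]
    exact Finset.sum_congr rfl fun _ _ => Finset.sum_congr rfl fun _ _ => by ring
  intro j hj
  by_contra hjt
  have hlt : ∑ i, c i * Φ t (g j) i < c j := by
    have := ht.2 j hjt
    simp only [Pi.sub_apply, mul_sub, Finset.sum_sub_distrib] at this
    simp [Pi.single_apply] at this
    linarith
  have hnn : ∀ i, 0 ≤ Φ s y i := fun i => by
    by_cases hi : i ∈ s
    · exact (hpos i hi).le
    · exact (coord_apply_of_notMem (hΦ s hs.1) hy hi).ge
  have : ∑ i, c i * Φ t y i < ∑ i, c i * Φ s y i := by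
    rw [hexp]
    refine Finset.sum_lt_sum (fun i _ => ?_) ⟨j, Finset.mem_univ j, ?_⟩
    · rw [mul_comm (c i)]; exact mul_le_mul_of_nonneg_left (key i) (hnn i)
    · rw [mul_comm (c j)]; exact mul_lt_mul_of_pos_left hlt (hpos j hj)
  linarith

/-- With `a` and `b` the coordinates of the point and of the direction, this turns positivity after
displacement into the half-open condition: `a ≥ 0`, and `a > 0` where `b < 0`. -/
theorem eventually_add_mul_ne_zero (a : ℝ) {b : ℝ} (hb : b ≠ 0) :
    ∀ᶠ ε : ℝ in nhdsWithin 0 (Set.Ioi 0),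
      a + ε * b ≠ 0 ∧ (0 < a + ε * b ↔ 0 ≤ a ∧ (b < 0 → 0 < a)) := by
  have ht : Filter.Tendsto (fun ε : ℝ => a + ε * b) (nhdsWithin 0 (Set.Ioi 0))
      (nhds (a + 0 * b)) :=
    (Continuous.tendsto (by fun_prop) 0).mono_left nhdsWithin_le_nhds
  rw [zero_mul, add_zero] at ht
  rcases lt_trichotomy a 0 with h | rfl | h
  · filter_upwards [ht.eventually (gt_mem_nhds h)] with ε hε
    exact ⟨hε.ne, iff_of_false (by linarith) (by rintro ⟨h', -⟩; linarith)⟩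
  · filter_upwards [self_mem_nhdsWithin] with ε hε
    have hε : 0 < ε := hε
    simp only [zero_add, le_refl, true_and, lt_self_iff_false, imp_false, not_lt]
    refine ⟨mul_ne_zero hε.ne' hb, ?_⟩
    rw [mul_pos_iff_of_pos_left hε]
    exact ⟨le_of_lt, fun h => lt_of_le_of_ne h hb.symm⟩
  · filter_upwards [ht.eventually (lt_mem_nhds h)] with ε hε
    exact ⟨hε.ne', iff_of_true hε ⟨h.le, fun _ => h⟩⟩

/-- Finitely many nonzero functionals have a common point where none vanishes; the reduced cost at
`j` takes the value `1` on the unit vector of `j`. -/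
theorem exists_isGenericCost [DecidableEq ι] {Φ : Finset ι → E →ₗ[ℝ] (ι → ℝ)}
    (hΦ : ∀ s, IsBasisSet g s → ∀ j ∈ s, Φ s (g j) = Pi.single j 1) :
    ∃ c, IsGenericCost g Φ c := by
  let f : {p : Finset ι × ι // IsBasisSet g p.1 ∧ p.2 ∉ p.1} → Module.Dual ℝ (ι → ℝ) := fun p =>
    ∑ i, (Pi.single p.1.2 1 - Φ p.1.1 (g p.1.2) : ι → ℝ) i • LinearMap.proj i
  obtain ⟨c, hc⟩ := Module.Dual.exists_forall_ne_zero_of_forall_exists f (by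
    rintro ⟨⟨s, j⟩, hs, hj⟩
    refine ⟨Pi.single j 1, ?_⟩
    simp only [f, LinearMap.sum_apply, LinearMap.smul_apply, LinearMap.proj_apply, smul_eq_mul]
    rw [Finset.sum_eq_single j (fun i _ hij => by simp [hij]) (by simp)]
    simp [coord_apply_of_notMem (hΦ s hs) (hs.2 j) hj])
  refine ⟨c, fun s hs j hj => ?_⟩
  have := hc ⟨⟨s, j⟩, hs, hj⟩
  simp only [f, LinearMap.sum_apply, LinearMap.smul_apply, LinearMap.proj_apply, smul_eq_mul] at this
  simpa only [mul_comm] using this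

theorem exists_generic_direction [DecidableEq ι] {Φ : Finset ι → E →ₗ[ℝ] (ι → ℝ)}
    (hΦ : ∀ s, IsBasisSet g s → ∀ j ∈ s, Φ s (g j) = Pi.single j 1) :
    ∃ τ : ι → ℝ, (∀ i, 0 < τ i) ∧
      ∀ s, IsBasisSet g s → ∀ i ∈ s, Φ s (∑ i, τ i • g i) i ≠ 0 := by
  let f : {p : Finset ι × ι // IsBasisSet g p.1 ∧ p.2 ∈ p.1} → Module.Dual ℝ (ι → ℝ) := fun p =>
    LinearMap.proj p.1.2 ∘ₗ Φ p.1.1 ∘ₗ Fintype.linearCombination ℝ g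
  obtain ⟨c, hc⟩ := Module.Dual.exists_forall_ne_zero_of_forall_exists f (by
    rintro ⟨⟨s, j⟩, hs, hj⟩
    refine ⟨Pi.single j 1, ?_⟩
    simp [f, Fintype.linearCombination_apply_single, hΦ s hs j hj])
  -- The generic vector `c` may have negative entries, so the all-ones vector is perturbed slightly
  -- towards it.
  have h1 : ∀ᶠ ε : ℝ in nhdsWithin 0 (Set.Ioi 0), ∀ i, 0 < 1 + ε * c i := by
    rw [Filter.eventually_all]
    intro i
    have : Filter.Tendsto (fun ε : ℝ => 1 + ε * c i) (nhdsWithin 0 (Set.Ioi 0))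
        (nhds (1 + 0 * c i)) :=
      (Continuous.tendsto (by fun_prop) 0).mono_left nhdsWithin_le_nhds
    exact this.eventually (lt_mem_nhds (by simp))
  have h2 : ∀ᶠ ε : ℝ in nhdsWithin 0 (Set.Ioi 0), ∀ p, f p (fun _ => 1) + ε * f p c ≠ 0 := by
    rw [Filter.eventually_all]
    exact fun p => (eventually_add_mul_ne_zero _ (hc p)).mono fun ε h => h.1
  obtain ⟨ε, h1, h2⟩ := (h1.and h2).exists
  refine ⟨fun i => 1 + ε * c i, h1, fun s hs i hi => ?_⟩
  have h3 := h2 ⟨⟨s, i⟩, hs, hi⟩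
  rw [← smul_eq_mul, ← map_smul, ← map_add] at h3
  simpa only [f, LinearMap.comp_apply, Fintype.linearCombination_apply, LinearMap.proj_apply,
    Pi.add_apply, Pi.smul_apply, smul_eq_mul] using h3

/-- A pointed finitely generated cone is the disjoint union of half-open simplicial cones, each
spanned by a basis chosen among the generators. -/
theorem exists_halfOpen_triangulation {n : ℕ} [DecidableEq ι] [Nonempty ι] (g : ι → Fin n → ℝ)
    (h : (Fin n → ℝ) →ₗ[ℝ] ℝ) (hg : ∀ i, 0 < h (g i)) :
    ∃ (T : Finset (Finset ι)) (I : Finset ι → Finset ι),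
      (∀ s ∈ T, IsBasisSet g s ∧ I s ⊆ s ∧ ∃ i ∈ s, i ∉ I s) ∧
      ∀ μ : ι → ℝ, (∀ i, 0 ≤ μ i) → ∃! s, s ∈ T ∧ ∑ i, μ i • g i ∈ halfOpenCone g s (I s) := by
  classical
  have hex : ∀ s : Finset ι, ∃ Φ : (Fin n → ℝ) →ₗ[ℝ] (ι → ℝ),
      IsBasisSet g s → ∀ j ∈ s, Φ (g j) = Pi.single j 1 := by
    intro s
    by_cases hs : IsBasisSet g s
    · obtain ⟨Φ, hΦ⟩ := exists_coord hs.1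
      exact ⟨Φ, fun _ => hΦ⟩
    · exact ⟨0, fun h => absurd h hs⟩
  choose Φ hΦ using hex
  obtain ⟨c, hc⟩ := exists_isGenericCost hΦ
  obtain ⟨τ, hτ, hu⟩ := exists_generic_direction hΦ
  set u := ∑ i, τ i • g i with hu_def
  have humem : ∀ {s}, IsBasisSet g s → u ∈ Submodule.span ℝ (g '' (s : Set ι)) :=
    fun hs => hs.sum_mem τ
  refine ⟨({s | IsCell g Φ c s} : Finset (Finset ι)),
    fun s => {i ∈ s | Φ s u i < 0}, fun s hs => ?_, fun μ hμ => ?_⟩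
  · have hs : IsCell g Φ c s := by simpa using hs
    refine ⟨hs.1, Finset.filter_subset _ _, ?_⟩
    -- Were every facet removed, `u` would have only nonpositive coordinates in `s` and `h u ≤ 0`;
    -- but `u` is a positive combination of the generators.
    by_contra! hall
    have hneg : ∀ i, Φ s u i ≤ 0 := fun i => by
      by_cases hi : i ∈ s
      · exact (Finset.mem_filter.1 (hall i hi)).2.le
      · exact (coord_apply_of_notMem (hΦ s hs.1) (humem hs.1) hi).le
    have h1 : h u = ∑ i, Φ s u i * h (g i) := by
      conv_lhs => rw [← sum_coord_smul (hΦ s hs.1) (humem hs.1)]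
      simp
    have h2 : h u = ∑ i, τ i * h (g i) := by rw [hu_def]; simp
    have h3 : 0 < h u := by
      rw [h2]; exact Finset.sum_pos (fun i _ => mul_pos (hτ i) (hg i)) Finset.univ_nonempty
    have h4 : h u ≤ 0 := by
      rw [h1]
      exact Finset.sum_nonpos fun i _ => mul_nonpos_of_nonpos_of_nonneg (hneg i) (hg i).le
    linarith
  · set x := ∑ i, μ i • g i with hx
    have hxmem : ∀ {s}, IsBasisSet g s → x ∈ Submodule.span ℝ (g '' (s : Set ι)) :=
      fun hs => hs.sum_mem μ
    have hev : ∀ᶠ ε : ℝ in nhdsWithin 0 (Set.Ioi 0), ∀ (s : Finset ι) (i : ι), IsBasisSet g s →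
        i ∈ s → Φ s x i + ε * Φ s u i ≠ 0 ∧
          (0 < Φ s x i + ε * Φ s u i ↔ 0 ≤ Φ s x i ∧ (Φ s u i < 0 → 0 < Φ s x i)) := by
      rw [Filter.eventually_all]; intro s
      rw [Filter.eventually_all]; intro i
      by_cases hsi : IsBasisSet g s ∧ i ∈ s
      · exact (eventually_add_mul_ne_zero _ (hu s hsi.1 i hsi.2)).mono fun ε h _ _ => h
      · exact Filter.Eventually.of_forall fun ε h1 h2 => absurd ⟨h1, h2⟩ hsi
    obtain ⟨ε, hε, hε0⟩ := (hev.and self_mem_nhdsWithin).exists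
    have hε0 : 0 < ε := hε0
    have hy : ∑ i, (μ i + ε * τ i) • g i = x + ε • u := by
      simp only [add_smul, mul_smul, Finset.sum_add_distrib, ← Finset.smul_sum, hx, hu_def]
    have hΦy : ∀ s i, Φ s (x + ε • u) i = Φ s x i + ε * Φ s u i := by simp
    -- Membership of `x` in a half-open cone means that `x + ε u` is interior to the closed one, so
    -- existence and uniqueness reduce to a generic point.
    have hiff : ∀ s, IsBasisSet g s → (x ∈ halfOpenCone g s {i ∈ s | Φ s u i < 0} ↔
        ∀ i ∈ s, 0 < Φ s (x + ε • u) i) := by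
      intro s hs
      constructor
      · rintro ⟨ν, h0, h1, h2, h3⟩ i hi
        have hν : Φ s x = ν := by rw [← h3]; exact coord_sum_smul (hΦ s hs) h2
        rw [hΦy, (hε s i hs hi).2, hν]
        exact ⟨h0 i, fun h => h1 i (Finset.mem_filter.2 ⟨hi, h⟩)⟩
      · intro hpos
        simp only [hΦy] at hpos
        refine ⟨Φ s x, fun i => ?_, fun i hi => ?_, fun i hi => ?_, sum_coord_smul (hΦ s hs) (hxmem hs)⟩
        · by_cases hi : i ∈ s
          · exact ((hε s i hs hi).2.1 (hpos i hi)).1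
          · exact (coord_apply_of_notMem (hΦ s hs) (hxmem hs) hi).ge
        · have hi := Finset.mem_filter.1 hi
          exact ((hε s i hs hi.1).2.1 (hpos i hi.1)).2 hi.2
        · exact coord_apply_of_notMem (hΦ s hs) (hxmem hs) hi
    obtain ⟨s, hs, hpos⟩ := exists_isCell h hg hΦ hc (μ := fun i => μ i + ε * τ i)
      (fun i => add_nonneg (hμ i) (mul_nonneg hε0.le (hτ i).le))
      (fun s hs i hi => by rw [hy, hΦy]; exact (hε s i hs hi).1)
    rw [hy] at hpos
    refine ⟨s, ⟨by simpa using hs, (hiff s hs.1).2 hpos⟩, ?_⟩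
    rintro t ⟨ht, hxt⟩
    have ht : IsCell g Φ c t := by simpa using ht
    have hpos' := (hiff t ht.1).1 hxt
    have hmem : ∀ {s}, IsBasisSet g s → x + ε • u ∈ Submodule.span ℝ (g '' (s : Set ι)) :=
      fun hs => Submodule.add_mem _ (hxmem hs) (Submodule.smul_mem _ _ (humem hs))
    rcases le_total (∑ i, c i * Φ s (x + ε • u) i) (∑ i, c i * Φ t (x + ε • u) i) with hle | hle
    · exact (hs.1.eq_of_subset ht.1 (hs.subset hΦ ht (hmem hs.1) hpos hle)).symm
    · exact ht.1.eq_of_subset hs.1 (ht.subset hΦ hs (hmem ht.1) hpos' hle)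

end Triangulation

variable {d : ℕ}

/-! ### The series of one half-open simplicial cone. -/

section Cell

variable {κ : Type*}

/-- Coordinates in the fundamental parallelepiped of a half-open simplicial cone. -/
def IsBoxCoord (I : Finset κ) (x : κ → ℝ) : Prop :=
  ∀ i, 0 ≤ x i ∧ x i ≤ 1 ∧ (i ∈ I → 0 < x i) ∧ (i ∉ I → x i < 1)

theorem IsBoxCoord.eq_of_add_eq {I : Finset κ} {x x' : κ → ℝ} (hx : IsBoxCoord I x)
    (hx' : IsBoxCoord I x') {l l' : κ →₀ ℕ} (h : ∀ i, (l i : ℝ) + x i = l' i + x' i) : l = l' := by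
  ext i
  obtain ⟨h1, h2, h3, h4⟩ := hx i
  obtain ⟨h1', h2', h3', h4'⟩ := hx' i
  have hi := h i
  by_cases hI : i ∈ I
  · have := h3 hI; have := h3' hI
    have a : (l i : ℝ) < l' i + 1 := by linarith
    have b : (l' i : ℝ) < l i + 1 := by linarith
    have a : l i < l' i + 1 := by exact_mod_cast a
    have b : l' i < l i + 1 := by exact_mod_cast b
    omega
  · have := h4 hI; have := h4' hI
    have a : (l i : ℝ) < l' i + 1 := by linarith
    have b : (l' i : ℝ) < l i + 1 := by linarith
    have a : l i < l' i + 1 := by exact_mod_cast a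
    have b : l' i < l i + 1 := by exact_mod_cast b
    omega

variable [Fintype κ]

/-- The polynomial `w(∑ y i v i)` in the variables `y i`. -/
def pullback (v : κ → Fin (d + 1) → ℤ) (w : MvPolynomial (Fin (d + 1)) ℝ) : MvPolynomial κ ℝ :=
  MvPolynomial.bind₁ (fun j => ∑ i, MvPolynomial.C (v i j : ℝ) * MvPolynomial.X i) w

theorem eval_pullback (v : κ → Fin (d + 1) → ℤ) (w : MvPolynomial (Fin (d + 1)) ℝ) (y : κ → ℝ) :
    MvPolynomial.eval y (pullback v w) = MvPolynomial.eval (∑ i, y i • intPoint (v i)) w := by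
  rw [pullback, MvPolynomial.eval, MvPolynomial.eval₂Hom_bind₁]
  congr 2
  ext j
  simp [intPoint, Finset.sum_apply, mul_comm]

theorem pullback_isHomogeneous (v : κ → Fin (d + 1) → ℤ) {w : MvPolynomial (Fin (d + 1)) ℝ}
    {m : ℕ} (hw : w.IsHomogeneous m) : (pullback v w).IsHomogeneous m := by
  have h := hw.aeval (fun j => ∑ i, MvPolynomial.C (v i j : ℝ) * MvPolynomial.X i) (n := 1)
    fun j => MvPolynomial.IsHomogeneous.sum _ _ _ fun i _ => MvPolynomial.isHomogeneous_C_mul_X _ _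
  rwa [one_mul] at h

theorem coe_expand {q : ℕ} (hq : q ≠ 0) (p : Polynomial ℝ) :
    PowerSeries.expand q hq (p : PowerSeries ℝ) =
      (Polynomial.expand ℝ q p : PowerSeries ℝ) := by
  ext n
  rw [PowerSeries.coeff_expand, Polynomial.coeff_coe, Polynomial.coeff_coe,
    Polynomial.coeff_expand (Nat.pos_of_ne_zero hq)]

/-- The lattice points of height `N` in a half-open simplicial cone. -/
def cellPoints (v : κ → Fin (d + 1) → ℤ) (I : Finset κ) (N : ℕ) : Set (Fin (d + 1) → ℤ) :=
  {z | (∃ ν : κ → ℝ, (∀ i, 0 ≤ ν i) ∧ (∀ i ∈ I, 0 < ν i) ∧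
    ∑ i, ν i • intPoint (v i) = intPoint z) ∧ z (Fin.last d) = N}

/-- The lattice points of the fundamental parallelepiped of a half-open simplicial cone. -/
def boxPoints (v : κ → Fin (d + 1) → ℤ) (I : Finset κ) : Set (Fin (d + 1) → ℤ) :=
  {b | ∃ x : κ → ℝ, IsBoxCoord I x ∧ ∑ i, x i • intPoint (v i) = intPoint b}

theorem boxPoints_finite (v : κ → Fin (d + 1) → ℤ) (I : Finset κ) : (boxPoints v I).Finite := by
  refine (Set.finite_Icc (fun j => -∑ i, |v i j|) (fun j => ∑ i, |v i j|)).subset ?_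
  rintro b ⟨x, hx, hb⟩
  have key : ∀ j, |b j| ≤ ∑ i, |v i j| := by
    intro j
    have h1 := congrFun hb j
    simp only [intPoint, Finset.sum_apply, Pi.smul_apply, smul_eq_mul] at h1
    have h2 : |(b j : ℝ)| ≤ ∑ i, |(v i j : ℝ)| := by
      rw [← h1]
      refine (Finset.abs_sum_le_sum_abs _ _).trans (Finset.sum_le_sum fun i _ => ?_)
      rw [abs_mul, abs_of_nonneg (hx i).1]
      exact mul_le_of_le_one_left (abs_nonneg _) (hx i).2.1
    exact_mod_cast h2
  exact ⟨fun j => (abs_le.1 (key j)).1, fun j => (abs_le.1 (key j)).2⟩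

/-- Subtract the floor of `ν i` where zero is allowed, and the ceiling minus one where the
coordinate must stay positive. -/
theorem exists_boxCoord (I : Finset κ) {ν : κ → ℝ} (h0 : ∀ i, 0 ≤ ν i) (hI : ∀ i ∈ I, 0 < ν i) :
    ∃ l : κ →₀ ℕ, IsBoxCoord I fun i => ν i - l i := by
  have key : ∀ i, ∃ n : ℕ, 0 ≤ ν i - n ∧ ν i - n ≤ 1 ∧ (i ∈ I → 0 < ν i - n) ∧
      (i ∉ I → ν i - n < 1) := by
    intro i
    by_cases hi : i ∈ I
    · obtain ⟨n, hn⟩ : ∃ n, ⌈ν i⌉₊ = n + 1 :=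
        ⟨⌈ν i⌉₊ - 1, by have := Nat.ceil_pos.2 (hI i hi); omega⟩
      have h1 := Nat.le_ceil (ν i)
      have h2 := Nat.ceil_lt_add_one (h0 i)
      rw [hn] at h1 h2
      push_cast at h1 h2
      exact ⟨n, by linarith, by linarith, fun _ => by linarith, fun h => absurd hi h⟩
    · have h1 := Nat.floor_le (h0 i)
      have h2 := Nat.lt_floor_add_one (ν i)
      exact ⟨⌊ν i⌋₊, by linarith, by linarith, fun h => absurd h hi, fun _ => by linarith⟩
  choose n hn using key
  exact ⟨Finsupp.equivFunOnFinite.symm n, fun i => by simpa using hn i⟩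

theorem intPoint_add_sum (v : κ → Fin (d + 1) → ℤ) (b : Fin (d + 1) → ℤ) (l : κ →₀ ℕ) :
    intPoint (b + ∑ i, l i • v i) = intPoint b + ∑ i, (l i : ℝ) • intPoint (v i) := by
  ext j; simp [intPoint, Finset.sum_apply]

theorem last_add_sum {v : κ → Fin (d + 1) → ℤ} {q : ℕ} (hv : ∀ i, v i (Fin.last d) = q)
    (b : Fin (d + 1) → ℤ) (l : κ →₀ ℕ) :
    (b + ∑ i, l i • v i) (Fin.last d) = b (Fin.last d) + q * ((∑ i, l i : ℕ) : ℤ) := by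
  simp [Finset.sum_apply, hv, Finset.mul_sum, mul_comm]

theorem last_eq_sum {v : κ → Fin (d + 1) → ℤ} {q : ℕ} (hv : ∀ i, v i (Fin.last d) = q)
    {x : κ → ℝ} {b : Fin (d + 1) → ℤ} (hb : ∑ i, x i • intPoint (v i) = intPoint b) :
    (b (Fin.last d) : ℝ) = q * ∑ i, x i := by
  have := congrFun hb (Fin.last d)
  simp only [intPoint, Finset.sum_apply, Pi.smul_apply, smul_eq_mul, hv] at this
  rw [← this, Finset.mul_sum]
  exact Finset.sum_congr rfl fun i _ => by push_cast; ring

/-- The lattice points of a half-open simplicial cone are, uniquely, sums of a lattice point of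
the fundamental parallelepiped and a combination of the generators over `ℕ`. -/
theorem cellSeries_eq_sum [DecidableEq κ] {v : κ → Fin (d + 1) → ℤ}
    (hli : LinearIndependent ℝ fun i => intPoint (v i)) {q : ℕ} (hq : q ≠ 0)
    (hv : ∀ i, v i (Fin.last d) = q) (I : Finset κ) {x : (Fin (d + 1) → ℤ) → κ → ℝ}
    (hx : ∀ b ∈ boxPoints v I, IsBoxCoord I (x b) ∧ ∑ i, x b i • intPoint (v i) = intPoint b)
    (w : MvPolynomial (Fin (d + 1)) ℝ) :
    PowerSeries.mk (fun N => ∑ᶠ z ∈ cellPoints v I N, MvPolynomial.eval (intPoint z) w) =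
      ∑ b ∈ (boxPoints_finite v I).toFinset, PowerSeries.X ^ (b (Fin.last d)).toNat *
        PowerSeries.expand q hq (orthantSeries (x b) (pullback v w)) := by
  have hinj : ∀ a a' : κ → ℝ, ∑ i, a i • intPoint (v i) = ∑ i, a' i • intPoint (v i) →
      ∀ i, a i = a' i := fun a a' h i => sub_eq_zero.1 <|
    Fintype.linearIndependent_iff.1 hli (fun i => a i - a' i)
      (by simp only [sub_smul, Finset.sum_sub_distrib, h, sub_self]) i
  ext N
  rw [PowerSeries.coeff_mk, map_sum]
  set B := (boxPoints_finite v I).toFinset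
  have hB : ∀ {b}, b ∈ B ↔ b ∈ boxPoints v I := by simp [B]
  have hlast : ∀ {b}, b ∈ boxPoints v I → 0 ≤ b (Fin.last d) := by
    rintro b ⟨y, hy, hb⟩
    have h1 := last_eq_sum hv hb
    have h2 : (0 : ℝ) ≤ b (Fin.last d) := by
      rw [h1]; exact mul_nonneg (Nat.cast_nonneg _) (Finset.sum_nonneg fun i _ => (hy i).1)
    exact_mod_cast h2
  -- `D b` collects the `l` with `height b + q |l| = N`. The two guards mirror the case splits in
  -- the coefficients of a shifted and of an expanded series.
  let D : (Fin (d + 1) → ℤ) → Finset (κ →₀ ℕ) := fun b =>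
    if (b (Fin.last d)).toNat ≤ N then
      if q ∣ N - (b (Fin.last d)).toNat then
        Finset.finsuppAntidiag Finset.univ ((N - (b (Fin.last d)).toNat) / q)
      else ∅
    else ∅
  have hD : ∀ b l, l ∈ D b ↔ (b (Fin.last d)).toNat + q * ∑ i, l i = N := by
    intro b l
    simp only [D]
    split_ifs with h1 h2
    · simp only [Finset.mem_finsuppAntidiag, Finset.subset_univ, and_true]
      obtain ⟨c, hc⟩ := h2
      rw [hc, Nat.mul_div_cancel_left _ (Nat.pos_of_ne_zero hq)]
      constructor
      · intro h; rw [h]; omega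
      · intro h
        refine Nat.eq_of_mul_eq_mul_left (Nat.pos_of_ne_zero hq) ?_
        change q * ∑ i, l i = q * c
        omega
    · simp only [Finset.notMem_empty, false_iff]
      rintro rfl
      exact h2 (by simp)
    · simp only [Finset.notMem_empty, false_iff]
      rintro rfl
      exact h1 (by simp)
  have hcoeff : ∀ b ∈ B, PowerSeries.coeff N (PowerSeries.X ^ (b (Fin.last d)).toNat *
      PowerSeries.expand q hq (orthantSeries (x b) (pullback v w))) =
      ∑ l ∈ D b, MvPolynomial.eval (intPoint (b + ∑ i, l i • v i)) w := by
    intro b hb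
    rw [PowerSeries.coeff_X_pow_mul', PowerSeries.coeff_expand]
    simp only [D]
    split_ifs
    · rw [orthantSeries, PowerSeries.coeff_mk]
      refine Finset.sum_congr rfl fun l _ => ?_
      rw [eval_pullback, intPoint_add_sum, ← (hx b (hB.1 hb)).2, ← Finset.sum_add_distrib]
      congr 2
      exact Finset.sum_congr rfl fun i _ => (add_smul _ _ _).trans (add_comm _ _)
    · simp
    · simp
  rw [Finset.sum_congr rfl hcoeff, Finset.sum_sigma']
  have himage : cellPoints v I N = ((B.sigma D).image fun p => p.1 + ∑ i, p.2 i • v i : Finset _) := by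
    ext z
    simp only [Finset.coe_image, Set.mem_image, Finset.mem_coe, Finset.mem_sigma, hD, hB]
    constructor
    · rintro ⟨⟨ν, h0, hI, hz⟩, hN⟩
      obtain ⟨l, hl⟩ := exists_boxCoord I h0 hI
      have hbox : z - ∑ i, l i • v i ∈ boxPoints v I := by
        refine ⟨_, hl, ?_⟩
        have := intPoint_add_sum v (z - ∑ i, l i • v i) l
        rw [sub_add_cancel, ← hz] at this
        simp only [sub_smul, Finset.sum_sub_distrib]
        exact sub_eq_of_eq_add this
      refine ⟨⟨z - ∑ i, l i • v i, l⟩, ⟨hbox, ?_⟩, sub_add_cancel _ _⟩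
      have h1 := hlast hbox
      have h2 := last_add_sum hv (z - ∑ i, l i • v i) l
      rw [sub_add_cancel, hN] at h2
      zify
      rw [Int.toNat_of_nonneg h1, h2]
      push_cast; ring
    · rintro ⟨⟨b, l⟩, ⟨hb, hN⟩, rfl⟩
      obtain ⟨hx1, hx2⟩ := hx b hb
      refine ⟨⟨fun i => x b i + l i, fun i => add_nonneg (hx1 i).1 (Nat.cast_nonneg _),
        fun i hi => add_pos_of_pos_of_nonneg ((hx1 i).2.2.1 hi) (Nat.cast_nonneg _), ?_⟩, ?_⟩
      · simp only [intPoint_add_sum, add_smul, Finset.sum_add_distrib, hx2]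
      · rw [last_add_sum hv, ← hN]
        push_cast
        rw [Int.toNat_of_nonneg (hlast hb)]
  rw [himage, finsum_mem_coe_finset, Finset.sum_image]
  rintro ⟨b, l⟩ hp ⟨b', l'⟩ hp' h
  simp only [Finset.coe_sigma, Set.mem_sigma_iff, Finset.mem_coe, hB] at hp hp' h
  have hl : l = l' := by
    refine (hx b hp.1).1.eq_of_add_eq (hx b' hp'.1).1 fun i => ?_
    have h1 := congrArg intPoint h
    rw [intPoint_add_sum, intPoint_add_sum, ← (hx b hp.1).2, ← (hx b' hp'.1).2,
      ← Finset.sum_add_distrib, ← Finset.sum_add_distrib] at h1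
    simp only [← add_smul] at h1
    linarith [hinj _ _ h1 i]
  subst hl
  simpa using h

/-- The numerator polynomial of a half-open simplicial cone. -/
theorem exists_cell_numerator [DecidableEq κ] {v : κ → Fin (d + 1) → ℤ}
    (hli : LinearIndependent ℝ fun i => intPoint (v i)) {q : ℕ} (hq : q ≠ 0)
    (hv : ∀ i, v i (Fin.last d) = q) (I : Finset κ) (hI : ∃ i, i ∉ I)
    {w : MvPolynomial (Fin (d + 1)) ℝ} {m : ℕ} (hw : w.IsHomogeneous m) :
    ∃ p : Polynomial ℝ,
      (1 - PowerSeries.X ^ q) ^ (Fintype.card κ + m) *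
        PowerSeries.mk (fun N => ∑ᶠ z ∈ cellPoints v I N, MvPolynomial.eval (intPoint z) w) =
          (p : PowerSeries ℝ) ∧
      p.natDegree < q * (Fintype.card κ + m) ∧
      ((∀ a, 0 ≤ (pullback v w).coeff a) → ∀ n, 0 ≤ p.coeff n) ∧
      ((∀ y : κ → ℝ, (∀ i, 0 ≤ y i) → 0 ≤ MvPolynomial.eval y (pullback v w)) →
        ∀ t : ℝ, 0 ≤ t → 0 ≤ p.eval t) := by
  have hex : ∀ b, ∃ x : κ → ℝ, b ∈ boxPoints v I →
      IsBoxCoord I x ∧ ∑ i, x i • intPoint (v i) = intPoint b := by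
    intro b
    by_cases hb : b ∈ boxPoints v I
    · obtain ⟨x, hx⟩ := hb
      exact ⟨x, fun _ => hx⟩
    · exact ⟨0, fun h => absurd h hb⟩
  choose x hx using hex
  have hW := pullback_isHomogeneous v hw
  have hB : ∀ {b}, b ∈ (boxPoints_finite v I).toFinset ↔ b ∈ boxPoints v I := by simp
  refine ⟨∑ b ∈ (boxPoints_finite v I).toFinset, Polynomial.X ^ (b (Fin.last d)).toNat *
    Polynomial.expand ℝ q (orthantNum (x b) (pullback v w)), ?_, ?_, fun hc n => ?_,
    fun hpos t ht => ?_⟩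
  · rw [cellSeries_eq_sum hli hq hv I hx, Finset.mul_sum, ← Polynomial.coeToPowerSeries.ringHom_apply,
      map_sum]
    refine Finset.sum_congr rfl fun b _ => ?_
    rw [Polynomial.coeToPowerSeries.ringHom_apply, Polynomial.coe_mul, Polynomial.coe_pow,
      Polynomial.coe_X, ← coe_expand hq, ← one_sub_pow_mul_orthantSeries (x b) hW, map_mul, map_pow,
      map_sub, map_one, PowerSeries.expand_X]
    ring
  · obtain ⟨i₀, hi₀⟩ := hI
    have hcard : 0 < Fintype.card κ := Fintype.card_pos_iff.2 ⟨i₀⟩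
    have hpos : 0 < q * (Fintype.card κ + m) := Nat.mul_pos (Nat.pos_of_ne_zero hq) (by omega)
    refine Nat.lt_of_le_pred hpos (Polynomial.natDegree_sum_le_of_forall_le _ _ fun b hb => ?_)
    refine Nat.le_pred_of_lt ?_
    obtain ⟨hx1, hx2⟩ := hx b (hB.1 hb)
    -- The coordinate `i₀ ∉ I` is strictly below `1`, so the height of `b` is strictly below `q`
    -- times the number of generators.
    have hsum : ∑ i, x b i < Fintype.card κ := by
      have := Finset.sum_lt_sum (s := Finset.univ) (f := x b) (g := fun _ => 1)
        (fun i _ => (hx1 i).2.1) ⟨i₀, Finset.mem_univ _, (hx1 i₀).2.2.2 hi₀⟩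
      simpa using this
    have hq' : (0 : ℝ) < q := by exact_mod_cast Nat.pos_of_ne_zero hq
    have h1 : (b (Fin.last d) : ℝ) < q * Fintype.card κ := by
      rw [last_eq_sum hv hx2]; exact mul_lt_mul_of_pos_left hsum hq'
    have h2 : b (Fin.last d) < ((q * Fintype.card κ : ℕ) : ℤ) := by exact_mod_cast h1
    have h3 : (b (Fin.last d)).toNat < q * Fintype.card κ := by
      have := Nat.mul_pos (Nat.pos_of_ne_zero hq) hcard
      omega
    refine (Polynomial.natDegree_mul_le).trans_lt ?_
    rw [Polynomial.natDegree_X_pow, Polynomial.natDegree_expand, mul_add]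
    have h4 := Nat.mul_le_mul_left q (orthantNum_natDegree_le (x b) hW)
    rw [mul_comm q (Polynomial.natDegree _)] at h4
    omega
  · rw [Polynomial.finsetSum_coeff]
    refine Finset.sum_nonneg fun b hb => ?_
    obtain ⟨hx1, -⟩ := hx b (hB.1 hb)
    rw [Polynomial.coeff_X_pow_mul']
    split_ifs
    · rw [Polynomial.coeff_expand (Nat.pos_of_ne_zero hq)]
      split_ifs
      · exact orthantNum_coeff_nonneg (fun i => (hx1 i).1) (fun i => (hx1 i).2.1) hc _
      · exact le_rfl
    · exact le_rfl
  · rw [Polynomial.eval_finsetSum]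
    refine Finset.sum_nonneg fun b hb => ?_
    obtain ⟨hx1, -⟩ := hx b (hB.1 hb)
    rw [Polynomial.eval_mul, Polynomial.eval_pow, Polynomial.eval_X, Polynomial.expand_eval]
    exact mul_nonneg (pow_nonneg ht _) (orthantNum_eval_nonneg (fun i => (hx1 i).1)
      (fun i => (hx1 i).2.1) hW hpos (pow_nonneg ht _))

end Cell

/-! ### Rational polytopes and generators of their cones. -/

theorem denominator_spec {P : Set (Fin d → ℝ)} (hP : IsRationalPolytope P) :
    0 < denominator P ∧ ∀ v ∈ Set.extremePoints ℝ P, ∃ z : Fin d → ℤ,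
      ∀ i, (denominator P : ℝ) * v i = z i := by
  refine Nat.sInf_mem (s := {q : ℕ | 0 < q ∧ ∀ v ∈ Set.extremePoints ℝ P, ∃ z : Fin d → ℤ,
    ∀ i, (q : ℝ) * v i = z i}) ?_
  obtain ⟨V, rfl⟩ := hP
  -- The product of all coordinate denominators shows that the set whose infimum is taken is
  -- nonempty.
  refine ⟨∏ v ∈ V, ∏ i, (v i).den, Finset.prod_pos fun v _ => Finset.prod_pos fun i _ =>
    (v i).den_pos, fun x hx => ?_⟩
  obtain ⟨v, hv, rfl⟩ := extremePoints_convexHull_subset hx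
  have hdvd : ∀ i, (v i).den ∣ ∏ v ∈ V, ∏ i, (v i).den := fun i =>
    (Finset.dvd_prod_of_mem (fun i => (v i).den) (Finset.mem_univ i)).trans
      (Finset.dvd_prod_of_mem (fun v : Fin d → ℚ => ∏ i, (v i).den) hv)
  choose c hc using hdvd
  refine ⟨fun i => c i * (v i).num, fun i => ?_⟩
  rw [hc i]
  have h : ((v i).den : ℝ) * (v i : ℝ) = (v i).num := by exact_mod_cast Rat.den_mul_eq_num (v i)
  push_cast
  rw [← h]; ring

theorem finite_extremePoints {P : Set (Fin d → ℝ)} (hP : IsRationalPolytope P) :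
    (Set.extremePoints ℝ P).Finite := by
  obtain ⟨V, rfl⟩ := hP
  exact (V.finite_toSet.image _).subset extremePoints_convexHull_subset

/-- Krein–Milman; no closure is needed, since the hull of finitely many points is closed. -/
theorem convexHull_extremePoints {P : Set (Fin d → ℝ)} (hP : IsRationalPolytope P) :
    convexHull ℝ (Set.extremePoints ℝ P) = P := by
  have hfin := finite_extremePoints hP
  obtain ⟨V, hV⟩ := hP
  have hcomp : IsCompact P := hV ▸ (V.finite_toSet.image _).isCompact_convexHull ℝ
  have hconv : Convex ℝ P := hV ▸ convex_convexHull ℝ _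
  rw [← (hfin.isClosed_convexHull ℝ).closure_eq]
  exact closure_convexHull_extremePoints hcomp hconv

theorem lift_last (p : Fin d → ℝ) : lift p (Fin.last d) = 1 := by simp [lift]

theorem lift_castSucc (p : Fin d → ℝ) (i : Fin d) : lift p i.castSucc = p i := by simp [lift]

/-- The inclusion `p ↦ (p, 0)`. -/
def embed : (Fin d → ℝ) →ₗ[ℝ] (Fin (d + 1) → ℝ) where
  toFun p := Fin.snoc (α := fun _ => ℝ) p 0
  map_add' p p' := by ext i; refine Fin.lastCases ?_ (fun j => ?_) i <;> simp
  map_smul' c p := by ext i; refine Fin.lastCases ?_ (fun j => ?_) i <;> simp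

theorem embed_last (p : Fin d → ℝ) : embed p (Fin.last d) = 0 := by simp [embed]

theorem embed_castSucc (p : Fin d → ℝ) (i : Fin d) : embed p i.castSucc = p i := by simp [embed]

theorem lift_sub_lift (p p' : Fin d → ℝ) : lift p - lift p' = embed (p - p') := by
  ext i
  refine Fin.lastCases ?_ (fun j => ?_) i
  · simp [lift_last, embed_last]
  · simp only [Pi.sub_apply, lift_castSucc, embed_castSucc]

/-- The span is the direct sum of the direction space of `P` at height `0` and the line through one
lifted point. -/
theorem finrank_span_lift {P : Set (Fin d → ℝ)} (hne : P.Nonempty) :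
    Module.finrank ℝ (Submodule.span ℝ (lift '' P)) = dimension P + 1 := by
  obtain ⟨p₀, hp₀⟩ := hne
  have hinj : Function.Injective (embed (d := d)) := by
    intro p p' h
    ext i
    have := congrFun h i.castSucc
    rwa [embed_castSucc, embed_castSucc] at this
  have hspan : Submodule.span ℝ (lift '' P) =
      (vectorSpan ℝ P).map embed ⊔ Submodule.span ℝ {lift p₀} := by
    apply le_antisymm
    · rw [Submodule.span_le]
      rintro _ ⟨p, hp, rfl⟩
      have : lift p = embed (p - p₀) + lift p₀ := by rw [← lift_sub_lift, sub_add_cancel]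
      rw [this]
      exact Submodule.add_mem_sup (Submodule.mem_map_of_mem (vsub_mem_vectorSpan ℝ hp hp₀))
        (Submodule.mem_span_singleton_self _)
    · refine sup_le ?_ (Submodule.span_mono (by simpa using ⟨p₀, hp₀, rfl⟩))
      rw [vectorSpan, Submodule.map_span, Submodule.span_le]
      rintro _ ⟨_, ⟨p, hp, p', hp', rfl⟩, rfl⟩
      change embed (p - p') ∈ _
      rw [← lift_sub_lift]
      exact Submodule.sub_mem _ (Submodule.subset_span ⟨p, hp, rfl⟩)
        (Submodule.subset_span ⟨p', hp', rfl⟩)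
  have hdisj : (vectorSpan ℝ P).map embed ⊓ Submodule.span ℝ {lift p₀} = ⊥ := by
    rw [eq_bot_iff]
    rintro x ⟨⟨y, -, rfl⟩, hx⟩
    obtain ⟨c, hc⟩ := Submodule.mem_span_singleton.1 hx
    have := congrFun hc (Fin.last d)
    simp only [Pi.smul_apply, lift_last, embed_last, smul_eq_mul, mul_one] at this
    rw [this, zero_smul] at hc
    exact hc.symm
  have h := Submodule.finrank_sup_add_finrank_inf_eq ((vectorSpan ℝ P).map embed)
    (Submodule.span ℝ {lift p₀})
  have hp₀ne : lift p₀ ≠ 0 := fun h => by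
    have := congrFun h (Fin.last d)
    rw [lift_last] at this
    exact one_ne_zero this
  rw [← hspan, hdisj, finrank_bot, finrank_span_singleton hp₀ne, add_zero,
    ← (Submodule.equivMapOfInjective embed hinj (vectorSpan ℝ P)).finrank_eq] at h
  exact h

theorem cone_eq_of_convexHull {ι : Type*} [Fintype ι] [Nonempty ι] (p : ι → Fin d → ℝ) {q : ℝ}
    (hq : 0 < q) :
    cone (convexHull ℝ (Set.range p)) =
      {x | ∃ μ : ι → ℝ, (∀ i, 0 ≤ μ i) ∧ ∑ i, μ i • q • lift (p i) = x} := by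
  classical
  ext x
  constructor
  · rintro ⟨c, hc, y, hy, rfl⟩
    -- The points whose lift is a nonnegative combination of the generators form a convex set
    -- containing every `p i`.
    have hsub : convexHull ℝ (Set.range p) ⊆
        {y | ∃ μ : ι → ℝ, (∀ i, 0 ≤ μ i) ∧ ∑ i, μ i • q • lift (p i) = lift y} := by
      refine convexHull_min ?_ ?_
      · rintro _ ⟨i, rfl⟩
        refine ⟨Pi.single i q⁻¹, fun j => ?_, ?_⟩
        · rw [Pi.single_apply]; split_ifs
          · exact (inv_pos.2 hq).le
          · exact le_rfl
        · rw [Finset.sum_eq_single i (fun j _ hj => by simp [hj]) (by simp), Pi.single_eq_same,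
            smul_smul, inv_mul_cancel₀ hq.ne', one_smul]
      · rintro y ⟨μ, h0, h1⟩ y' ⟨μ', h0', h1'⟩ a b ha hb hab
        refine ⟨fun i => a * μ i + b * μ' i, fun i => add_nonneg (mul_nonneg ha (h0 i))
          (mul_nonneg hb (h0' i)), ?_⟩
        simp only [add_smul, Finset.sum_add_distrib]
        simp only [mul_smul a, mul_smul b, ← Finset.smul_sum, h1, h1']
        ext i
        refine Fin.lastCases ?_ (fun j => ?_) i
        · simp [lift_last, hab]
        · simp [lift_castSucc]
    obtain ⟨μ, h0, h1⟩ := hsub hy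
    refine ⟨fun i => c * μ i, fun i => mul_nonneg hc (h0 i), ?_⟩
    simp only [mul_smul c, ← Finset.smul_sum, h1]
  · rintro ⟨μ, h0, rfl⟩
    rcases (Finset.sum_nonneg fun i _ => h0 i : 0 ≤ ∑ i, μ i).eq_or_lt with hs | hs
    · have hz : ∀ i, μ i = 0 := fun i =>
        (Finset.sum_eq_zero_iff_of_nonneg fun i _ => h0 i).1 hs.symm i (Finset.mem_univ i)
      obtain ⟨i⟩ := ‹Nonempty ι›
      exact ⟨0, le_rfl, p i, subset_convexHull ℝ _ ⟨i, rfl⟩, by simp [hz]⟩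
    · refine ⟨q * ∑ i, μ i, (mul_pos hq hs).le, ∑ i, (μ i / ∑ i, μ i) • p i, ?_, ?_⟩
      · refine (convex_convexHull ℝ _).sum_mem (fun i _ => div_nonneg (h0 i) hs.le) ?_
          fun i _ => subset_convexHull ℝ _ ⟨i, rfl⟩
        rw [← Finset.sum_div, div_self hs.ne']
      · ext j
        refine Fin.lastCases ?_ (fun j => ?_) j
        · simp only [Finset.sum_apply, Pi.smul_apply, lift_last, smul_eq_mul, mul_one,
            ← Finset.sum_mul]
          ring
        · rw [Pi.smul_apply, lift_castSucc, Finset.sum_apply, Finset.sum_apply, Finset.smul_sum]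
          refine Finset.sum_congr rfl fun i _ => ?_
          simp only [Pi.smul_apply, lift_castSucc, smul_eq_mul]
          field_simp

/-- The cone over a nonempty rational polytope of denominator `q` is generated by lattice points
of height `q`. -/
theorem exists_generators {P : Set (Fin d → ℝ)} (hP : IsRationalPolytope P) (hne : P.Nonempty) :
    ∃ (ι : Type) (_ : Fintype ι) (_ : Nonempty ι) (v : ι → Fin (d + 1) → ℤ),
      (∀ i, v i (Fin.last d) = denominator P) ∧
      cone P = {x | ∃ μ : ι → ℝ, (∀ i, 0 ≤ μ i) ∧ ∑ i, μ i • intPoint (v i) = x} ∧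
      Module.finrank ℝ (Submodule.span ℝ (Set.range fun i => intPoint (v i))) =
        dimension P + 1 := by
  obtain ⟨hq, hz⟩ := denominator_spec hP
  have hhull := convexHull_extremePoints hP
  have hne' : (Set.extremePoints ℝ P).Nonempty := by
    rw [← convexHull_nonempty_iff (𝕜 := ℝ), hhull]; exact hne
  let ι := (Set.extremePoints ℝ P)
  let _ : Fintype ι := (finite_extremePoints hP).fintype
  have hι : Nonempty ι := hne'.to_subtype
  choose z hz using hz
  let v : ι → Fin (d + 1) → ℤ := fun i =>
    Fin.snoc (α := fun _ => ℤ) (z i i.2) (denominator P : ℤ)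
  have hv : ∀ i, intPoint (v i) = (denominator P : ℝ) • lift (i : Fin d → ℝ) := by
    intro i
    ext j
    refine Fin.lastCases ?_ (fun j => ?_) j
    · simp [intPoint, v, lift_last]
    · simp [intPoint, v, lift_castSucc, hz i i.2]
  have hq' : (0 : ℝ) < denominator P := by exact_mod_cast hq
  have hcone : cone P = {x | ∃ μ : ι → ℝ, (∀ i, 0 ≤ μ i) ∧ ∑ i, μ i • intPoint (v i) = x} := by
    simp only [hv]
    rw [← cone_eq_of_convexHull (fun i : ι => (i : Fin d → ℝ)) hq', Subtype.range_coe, hhull]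
  refine ⟨ι, inferInstance, hι, v, fun i => by simp [v], hcone, ?_⟩
  rw [← finrank_span_lift hne]
  suffices h : Submodule.span ℝ (Set.range fun i => intPoint (v i)) =
      Submodule.span ℝ (lift '' P) by rw [h]
  refine le_antisymm (Submodule.span_le.2 ?_) (Submodule.span_le.2 ?_)
  · rintro _ ⟨i, rfl⟩
    simp only [hv]
    exact Submodule.smul_mem _ _ (Submodule.subset_span ⟨i, i.2.1, rfl⟩)
  · rintro _ ⟨p, hp, rfl⟩
    have : lift p ∈ cone P := ⟨1, zero_le_one, p, hp, (one_smul _ _).symm⟩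
    rw [hcone] at this
    obtain ⟨μ, -, h⟩ := this
    rw [← h]
    exact Submodule.sum_mem _ fun i _ => Submodule.smul_mem _ _ (Submodule.subset_span ⟨i, rfl⟩)

theorem IsBasisSet.card_eq {ι : Type*} {E : Type*} [AddCommGroup E] [Module ℝ E] {g : ι → E}
    {s : Finset ι} (hs : IsBasisSet g s) :
    Fintype.card s = Module.finrank ℝ (Submodule.span ℝ (Set.range g)) := by
  have hli : LinearIndependent ℝ (fun i : s => g i) := hs.1
  rw [← finrank_span_eq_card hli]
  have hr : Set.range (fun i : s => g i) = g '' (s : Set ι) := by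
    ext; simp
  rw [hr]
  suffices h : Submodule.span ℝ (g '' (s : Set ι)) = Submodule.span ℝ (Set.range g) by rw [h]
  refine le_antisymm (Submodule.span_mono (Set.image_subset_range _ _)) (Submodule.span_le.2 ?_)
  rintro _ ⟨i, rfl⟩
  exact hs.2 i

theorem mem_halfOpenCone_iff {ι : Type*} {E : Type*} [AddCommGroup E] [Module ℝ E] [Fintype ι]
    [DecidableEq ι] {g : ι → E} {s I : Finset ι} {x : E} (hI : I ⊆ s) :
    x ∈ halfOpenCone g s I ↔ ∃ ν : s → ℝ, (∀ i, 0 ≤ ν i) ∧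
      (∀ i ∈ I.subtype (· ∈ s), 0 < ν i) ∧ ∑ i, ν i • g i = x := by
  constructor
  · rintro ⟨ν, h0, h1, h2, rfl⟩
    refine ⟨fun i => ν i, fun i => h0 i, fun i hi => h1 i (Finset.mem_subtype.1 hi), ?_⟩
    rw [Finset.sum_coe_sort s fun i => ν i • g i]
    exact Finset.sum_subset (Finset.subset_univ s) fun i _ hi => by rw [h2 i hi, zero_smul]
  · rintro ⟨ν, h0, h1, rfl⟩
    refine ⟨fun i => if h : i ∈ s then ν ⟨i, h⟩ else 0, fun i => ?_, fun i hi => ?_, fun i hi => ?_,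
      ?_⟩
    · dsimp only; split_ifs
      · exact h0 _
      · exact le_rfl
    · simpa [hI hi] using h1 ⟨i, hI hi⟩ (Finset.mem_subtype.2 hi)
    · simp [hi]
    · rw [← Finset.sum_subset (Finset.subset_univ s) fun i _ hi => by simp [hi],
        ← Finset.sum_coe_sort s]
      exact Finset.sum_congr rfl fun i _ => by simp

/-! ### Positivity of the weights, and assembly of the cells. -/

theorem pullback_coeff_nonneg {κ : Type*} [Fintype κ] {P : Set (Fin d → ℝ)}
    {v : κ → Fin (d + 1) → ℤ} (hv : ∀ i, intPoint (v i) ∈ cone P)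
    {w : MvPolynomial (Fin (d + 1)) ℝ} (hw : w ∈ semiringR P) :
    ∀ a, 0 ≤ (pullback v w).coeff a := by
  classical
  have hmul : ∀ p p' : MvPolynomial κ ℝ, (∀ a, 0 ≤ p.coeff a) → (∀ a, 0 ≤ p'.coeff a) →
      ∀ a, 0 ≤ (p * p').coeff a := by
    intro p p' hp hp' a
    rw [MvPolynomial.coeff_mul]
    exact Finset.sum_nonneg fun _ _ => mul_nonneg (hp _) (hp' _)
  have hC : ∀ c : ℝ, 0 ≤ c → ∀ a, 0 ≤ (MvPolynomial.C c : MvPolynomial κ ℝ).coeff a := by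
    intro c hc a
    rw [MvPolynomial.coeff_C]; split_ifs
    · exact hc
    · exact le_rfl
  induction hw using AddSubmonoid.closure_induction with
  | mem w hw =>
    obtain ⟨c, k, l, hc, hl, rfl⟩ := hw
    have hlin : ∀ j, pullback v (linearForm (l j)) =
        ∑ i, MvPolynomial.C (MvPolynomial.eval (intPoint (v i)) (linearForm (l j))) *
          MvPolynomial.X i := by
      intro j
      simp only [pullback, linearForm, map_sum, map_mul, MvPolynomial.bind₁_C_right,
        MvPolynomial.bind₁_X_right, MvPolynomial.eval_C, MvPolynomial.eval_X, Finset.mul_sum,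
        Finset.sum_mul, intPoint]
      rw [Finset.sum_comm]
      exact Finset.sum_congr rfl fun i _ => Finset.sum_congr rfl fun i' _ => by ring
    have : pullback v (MvPolynomial.C c * ∏ j, linearForm (l j)) =
        MvPolynomial.C c * ∏ j, pullback v (linearForm (l j)) := by
      simp [pullback, map_prod]
    rw [this]
    refine hmul _ _ (hC c hc) ?_
    refine Finset.prod_induction _ (fun p : MvPolynomial κ ℝ => ∀ a, 0 ≤ p.coeff a) hmul
      (by simpa using hC 1 zero_le_one) fun j _ a => ?_
    rw [hlin, MvPolynomial.coeff_sum]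
    refine Finset.sum_nonneg fun i _ => hmul _ _ (hC _ (hl j _ (hv i))) (fun a => ?_) a
    rw [MvPolynomial.coeff_X]; split_ifs <;> simp
  | zero => intro a; simp [pullback]
  | add w w' _ _ h h' =>
    intro a
    have : pullback v (w + w') = pullback v w + pullback v w' := by simp [pullback]
    rw [this, MvPolynomial.coeff_add]
    exact add_nonneg (h a) (h' a)

theorem eval_smul_of_isHomogeneous {κ : Type*} [Fintype κ] {W : MvPolynomial κ ℝ} {m : ℕ}
    (hW : W.IsHomogeneous m) (c : ℝ) (x : κ → ℝ) :
    MvPolynomial.eval (c • x) W = c ^ m * MvPolynomial.eval x W := by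
  simp only [MvPolynomial.eval_eq', Finset.mul_sum]
  refine Finset.sum_congr rfl fun a ha => ?_
  simp only [Pi.smul_apply, smul_eq_mul, mul_pow]
  rw [Finset.prod_mul_distrib, Finset.prod_pow_eq_pow_sum, sum_eq_of_isHomogeneous hW ha]
  ring

/-- Nonnegativity is given only at height `1`; homogeneity of the whole `w` carries it along rays,
although the individual products may have different degrees. -/
theorem eval_nonneg_of_mem_semiringS {P : Set (Fin d → ℝ)} {w : MvPolynomial (Fin (d + 1)) ℝ}
    {m : ℕ} (hm : w.IsHomogeneous m) (hw : w ∈ semiringS P) {x : Fin (d + 1) → ℝ}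
    (hx : x ∈ cone P) : 0 ≤ MvPolynomial.eval x w := by
  obtain ⟨c, hc, p, hp, rfl⟩ := hx
  have h : 0 ≤ MvPolynomial.eval (lift p) w := by
    clear hm
    induction hw using AddSubmonoid.closure_induction with
    | mem w hw =>
      obtain ⟨c, k, l, hc, hl, rfl⟩ := hw
      rw [map_mul, MvPolynomial.eval_C]
      exact mul_nonneg hc (hl p hp)
    | zero => simp
    | add w w' _ _ h h' => rw [map_add]; exact add_nonneg h h'
  rw [eval_smul_of_isHomogeneous hm]
  exact mul_nonneg (pow_nonneg hc m) h

/-- The Ehrhart series of a nonempty rational polytope is a sum of series of half-open simplicial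
cones spanned by lattice points of height `q`. -/
theorem exists_numerator {P : Set (Fin d → ℝ)} (hP : IsRationalPolytope P) (hne : P.Nonempty)
    {w : MvPolynomial (Fin (d + 1)) ℝ} {m : ℕ} (hw : w.IsHomogeneous m) :
    ∃ p : Polynomial ℝ,
      (1 - PowerSeries.X ^ denominator P) ^ (dimension P + m + 1) * ehrhartSeries P w =
          (p : PowerSeries ℝ) ∧
      p.natDegree < denominator P * (dimension P + m + 1) ∧
      (w ∈ semiringR P → ∀ n, 0 ≤ p.coeff n) ∧
      (w ∈ semiringS P → ∀ t : ℝ, 0 ≤ t → 0 ≤ p.eval t) := by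
  classical
  obtain ⟨ι, _, _, v, hv, hcone, hrank⟩ := exists_generators hP hne
  have hq : denominator P ≠ 0 := (denominator_spec hP).1.ne'
  set q := denominator P
  have hexp : dimension P + m + 1 = dimension P + 1 + m := by ring
  rw [hexp]
  obtain ⟨T, I, hT, huniq⟩ := exists_halfOpen_triangulation (fun i => intPoint (v i))
    (LinearMap.proj (Fin.last d)) (fun i => by
      simp only [LinearMap.proj_apply, intPoint, hv]
      exact_mod_cast Nat.pos_of_ne_zero hq)
  have hvcone : ∀ i, intPoint (v i) ∈ cone P := by
    intro i
    rw [hcone]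
    refine ⟨Pi.single i 1, fun j => ?_, ?_⟩
    · rw [Pi.single_apply]; split_ifs <;> simp
    · rw [Finset.sum_eq_single i (fun j _ hj => by simp [hj]) (by simp), Pi.single_eq_same, one_smul]
  let cell : Finset ι → ℕ → Set (Fin (d + 1) → ℤ) := fun s =>
    cellPoints (fun i : s => v i) ((I s).subtype (· ∈ s))
  have hcell : ∀ s : Finset ι, ∃ p : Polynomial ℝ, s ∈ T →
      (1 - PowerSeries.X ^ q) ^ (dimension P + 1 + m) *
        PowerSeries.mk (fun N => ∑ᶠ z ∈ cell s N, MvPolynomial.eval (intPoint z) w) =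
          (p : PowerSeries ℝ) ∧
      p.natDegree < q * (dimension P + 1 + m) ∧
      (w ∈ semiringR P → ∀ n, 0 ≤ p.coeff n) ∧
      (w ∈ semiringS P → ∀ t : ℝ, 0 ≤ t → 0 ≤ p.eval t) := by
    intro s
    by_cases hs : s ∈ T
    swap
    · exact ⟨0, fun h => absurd h hs⟩
    obtain ⟨hbasis, -, i₀, hi₀, hi₀I⟩ := hT s hs
    obtain ⟨p, h1, h2, h3, h4⟩ := exists_cell_numerator (v := fun i : s => v i) hbasis.1 hq
      (fun i => hv i) ((I s).subtype (· ∈ s)) ⟨⟨i₀, hi₀⟩, by simpa using hi₀I⟩ hw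
    rw [hbasis.card_eq, hrank] at h1 h2
    refine ⟨p, fun _ => ⟨h1, h2, fun hR => h3 (pullback_coeff_nonneg (fun i : s => hvcone i) hR),
      fun hS => h4 fun y hy => ?_⟩⟩
    rw [eval_pullback]
    refine eval_nonneg_of_mem_semiringS hw hS ?_
    rw [hcone]
    -- With no facet removed, this only pads `y` by zeros from `s` to all generators.
    obtain ⟨ν, h0, -, -, h⟩ := (mem_halfOpenCone_iff (g := fun i => intPoint (v i))
      (Finset.empty_subset s)).2 ⟨y, hy, fun i hi => by simp at hi, rfl⟩
    exact ⟨ν, h0, h⟩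
  choose p hp using hcell
  have hmem : ∀ s ∈ T, ∀ N z, z ∈ cell s N ↔
      intPoint z ∈ halfOpenCone (fun i => intPoint (v i)) s (I s) ∧ z (Fin.last d) = N := by
    intro s hs N z
    rw [mem_halfOpenCone_iff (hT s hs).2.1]
    rfl
  have hsub : ∀ s ∈ T, ∀ N, cell s N ⊆ latticePoints P N := by
    intro s hs N z hz
    obtain ⟨⟨ν, h0, -, -, h⟩, hN⟩ := (hmem s hs N z).1 hz
    refine ⟨?_, hN⟩
    rw [hcone]
    exact ⟨ν, h0, h⟩
  have hunion : ∀ N, latticePoints P N = ⋃ s ∈ (T : Set (Finset ι)), cell s N := by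
    intro N
    refine Set.Subset.antisymm ?_ (Set.iUnion₂_subset fun s hs => hsub s hs N)
    rintro z ⟨hz, hN⟩
    rw [hcone] at hz
    obtain ⟨μ, h0, h⟩ := hz
    obtain ⟨s, ⟨hs, hzs⟩, -⟩ := huniq μ h0
    rw [h] at hzs
    exact Set.mem_iUnion₂.2 ⟨s, hs, (hmem s hs N z).2 ⟨hzs, hN⟩⟩
  have hdisj : ∀ N, (T : Set (Finset ι)).PairwiseDisjoint fun s => cell s N := by
    intro N s hs t ht hst
    refine Set.disjoint_left.2 fun z hz hz' => hst ?_
    have h1 := (hmem s hs N z).1 hz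
    have h2 := (hmem t ht N z).1 hz'
    obtain ⟨ν, h0, -, -, h⟩ := h1.1
    have h1 := h1.1
    have h2 := h2.1
    rw [← h] at h1 h2
    exact (huniq ν h0).unique ⟨hs, h1⟩ ⟨ht, h2⟩
  have hseries : ehrhartSeries P w = ∑ s ∈ T,
      PowerSeries.mk (fun N => ∑ᶠ z ∈ cell s N, MvPolynomial.eval (intPoint z) w) := by
    ext N
    rw [ehrhartSeries, PowerSeries.coeff_mk, map_sum, hunion N, finsum_mem_biUnion (hdisj N)
      T.finite_toSet fun s hs => (latticePoints_finite hP N).subset (hsub s hs N),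
      finsum_mem_coe_finset]
    simp only [PowerSeries.coeff_mk]
  have hpos : 0 < q * (dimension P + 1 + m) := Nat.mul_pos (Nat.pos_of_ne_zero hq) (by omega)
  refine ⟨∑ s ∈ T, p s, ?_, ?_, fun hR n => ?_, fun hS t ht => ?_⟩
  · rw [hseries, Finset.mul_sum, ← Polynomial.coeToPowerSeries.ringHom_apply, map_sum]
    exact Finset.sum_congr rfl fun s hs => (hp s hs).1
  · exact Nat.lt_of_le_pred hpos (Polynomial.natDegree_sum_le_of_forall_le _ _ fun s hs =>
      Nat.le_pred_of_lt (hp s hs).2.1)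
  · rw [Polynomial.finsetSum_coeff]
    exact Finset.sum_nonneg fun s hs => (hp s hs).2.2.1 hR n
  · rw [Polynomial.eval_finsetSum]
    exact Finset.sum_nonneg fun s hs => (hp s hs).2.2.2 hS t ht

end WeightedEhrhart

end

theorem theorem2p5 {d : ℕ} (P : Set (Fin d → ℝ)) (hP : WeightedEhrhart.IsRationalPolytope P)
    (w : MvPolynomial (Fin (d + 1)) ℝ) (m : ℕ) (hw : w.IsHomogeneous m) :
    (1 - PowerSeries.X ^ WeightedEhrhart.denominator P) ^ WeightedEhrhart.hStarExponent P w *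
        WeightedEhrhart.ehrhartSeries P w =
      ((WeightedEhrhart.hStar P w : Polynomial ℝ) : PowerSeries ℝ) ∧
    (w ∈ WeightedEhrhart.semiringR P →
      ∀ n : ℕ, 0 ≤ (WeightedEhrhart.hStar P w).coeff n) ∧
    (w ∈ WeightedEhrhart.semiringS P →
      ∀ t : ℝ, 0 ≤ t → 0 ≤ (WeightedEhrhart.hStar P w).eval t) := by
  rcases P.eq_empty_or_nonempty with rfl | hne
  · have h : WeightedEhrhart.ehrhartSeries (∅ : Set (Fin d → ℝ)) w = 0 := by
      ext n
      simp [WeightedEhrhart.ehrhartSeries, WeightedEhrhart.latticePoints, WeightedEhrhart.cone]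
    simp [WeightedEhrhart.hStar, h]
  · have hw' : w.IsHomogeneous w.totalDegree := by
      rcases eq_or_ne w 0 with rfl | h0
      · exact MvPolynomial.isHomogeneous_zero _ _ _
      · rwa [hw.totalDegree h0]
    obtain ⟨p, h1, h2, h3, h4⟩ := WeightedEhrhart.exists_numerator hP hne hw'
    have hp : WeightedEhrhart.hStar P w = p := by
      rw [WeightedEhrhart.hStar, WeightedEhrhart.hStarExponent, h1]
      exact PowerSeries.trunc_coe_eq_self h2
    rw [hp]
    exact ⟨h1, h3, h4⟩
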